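/- Let $(R,\mathfrak m)$ be a Noetherian local ring of Krull dimension $2$, and let $I$ and $J$ be $\mathfrak m$-primary ideals of $R$. Write $\ell$ for the length of an $R$-module. For an $\mathfrak m$-primary ideal $K$, there is a unique polynomial $P_K\in\mathbb Q[x]$ of degree at most $2$ with $P_K(n)=\ell(R/K^n)$ for all large $n$ (the Hilbert polynomial of $K$); the multiplicity $e(K)$ is defined by $$P_K(n)=\frac{e(K)}{2}\,n^2+\text{terms of degree}<2 .$$ There is also a unique polynomial $P\in\mathbb Q[r,s]$ of total degree at most $2$ with $P(r,s)=\ell(R/I^rJ^s)$ for all large $r$ and $s$ (the Bhattacharya polynomial of $I$ and $J$); the mixed multiplicities $e_i(I|J)$, $i=0,1,2$, are defined by $$P(r,s)=\frac12\Big(e_0(I|J)\,r^2+2\,e_1(I|J)\,rs+e_2(I|J)\,s^2\Big)+\text{terms of degree}<2 .$$ The polynomials $P_I$, $P_J$, $P_{IJ}$ and $P$ exist and are unique as stated, and $$e(IJ)\le 2e(I)+2e(J)\qquad\text{and}\qquad e_1(I|J)^2\le e(I)\,e(J).$$ -/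

import Mathlib

open scoped Nat

/-- The ideal `I` of the local ring `R` is `𝔪`-primary, `𝔪` being the maximal ideal of `R`. -/
def IsMaximalPrimary {R : Type*} [CommRing R] [IsLocalRing R] (I : Ideal R) : Prop :=
  I.IsPrimary ∧ I.radical = IsLocalRing.maximalIdeal R

/-- `P` is the Hilbert(-Samuel) polynomial of `I`, in a ring of dimension `d`: it has degree at
most `d`, and for all large `n` the length of `R / I ^ n` is finite and equal to `P(n)`. -/
def IsHilbertPolynomial {R : Type*} [CommRing R] (d : ℕ) (I : Ideal R)
    (P : Polynomial ℚ) : Prop :=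
  P.natDegree ≤ d ∧
    ∃ N : ℕ, ∀ n : ℕ, N ≤ n →
      ∃ l : ℕ, Module.length R (R ⧸ I ^ n) = (l : ℕ∞) ∧ P.eval (n : ℚ) = (l : ℚ)

/-- `P` is the Bhattacharya polynomial of `I` and `J`, in a ring of dimension `d`: a polynomial
in two variables (`r` is the variable `0`, `s` is the variable `1`) of total degree at most `d`,
such that for all large `r` and `s` the length of `R / I ^ r J ^ s` is finite and equal
to `P(r, s)`. -/
def IsBhattacharyaPolynomial {R : Type*} [CommRing R] (d : ℕ) (I J : Ideal R)
    (P : MvPolynomial (Fin 2) ℚ) : Prop :=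
  P.totalDegree ≤ d ∧
    ∃ N : ℕ, ∀ r s : ℕ, N ≤ r → N ≤ s →
      ∃ l : ℕ, Module.length R (R ⧸ (I ^ r * J ^ s)) = (l : ℕ∞) ∧
        MvPolynomial.eval ![(r : ℚ), (s : ℚ)] P = (l : ℚ)

/-- The Hilbert polynomial of `I` (an unspecified polynomial if there is none). -/
noncomputable def hilbertPolynomial {R : Type*} [CommRing R] (d : ℕ) (I : Ideal R) :
    Polynomial ℚ :=
  Classical.epsilon (IsHilbertPolynomial d I)

/-- The Bhattacharya polynomial of `I` and `J` (an unspecified polynomial if there is none). -/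
noncomputable def bhattacharyaPolynomial {R : Type*} [CommRing R] (d : ℕ) (I J : Ideal R) :
    MvPolynomial (Fin 2) ℚ :=
  Classical.epsilon (IsBhattacharyaPolynomial d I J)

/-- The multiplicity `e(I)` of an ideal of a `d`-dimensional local ring: the Hilbert polynomial
of `I` is `e(I) n ^ d / d! +` terms of degree `< d`. -/
noncomputable def idealMultiplicity {R : Type*} [CommRing R] (d : ℕ) (I : Ideal R) : ℚ :=
  (d ! : ℚ) * (hilbertPolynomial d I).coeff d

/-- The mixed multiplicity `e_i(I|J)`, for `i ≤ d`, of two ideals of a `d`-dimensional local ring: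
the Bhattacharya polynomial is
`(1 / d!) ∑ i ≤ d, (d choose i) e_i(I|J) r ^ (d - i) s ^ i +` terms of degree `< d`. -/
noncomputable def mixedMultiplicity {R : Type*} [CommRing R] (d i : ℕ) (I J : Ideal R) : ℚ :=
  (d ! : ℚ) / (d.choose i : ℚ) *
    (bhattacharyaPolynomial d I J).coeff (Finsupp.single 0 (d - i) + Finsupp.single 1 i)

/-! Everything rests on superficial elements. Prime avoidance in the bigraded Rees algebra `⨁ I ^ r
J ^ s` gives, for every large degree `c`, an `f ∈ I ^ c` that cancels from `I ^ (r + c) * J ^ s + 𝔞`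
on elements of a fixed `I ^ r₀ + 𝔞`. Hence the colengths of `I ^ (r + c) * J ^ s + 𝔞` and `I ^ r * J
^ s + 𝔞` differ by that of `I ^ (r + c) * J ^ s + 𝔞 + (f)`, up to a bounded error that is eventually
constant. Since `f` lowers the dimension, induction makes the colength function a polynomial
(`eventuallyPoly_colength`).

Let its quadratic part be `a r² + b r s + γ s²`. Then `e(I) = 2a`, `e(J) = 2γ`, `e₁ = b` and `e(IJ)
= 2(a + b + γ)`, so both inequalities follow from `b² ≤ 4aγ`. To get this, cut `R / J ^ m` by powers
of one superficial `f` of degree `c` into slices `R / ((J ^ m : f ^ k) + (f))`. Each has length at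
least `b c m - 2 a c² k - C`, with `C` independent of `k` and `m` (`exists_slice_bound`). Summing
over `k < T` gives `T b c m - a c² T² ≤ γ m²` up to lower order terms. With `T / m` tending to `u /
(c v)`, this reads `b u v ≤ a u² + γ v²` for all naturals `u` and `v > 0`. The discriminant bound
follows because `a, b ≥ 0`. -/

/-! ### Nonzerodivisors in high degree and homogeneous prime avoidance -/

/-- For ideals `p`, `Q` of a Noetherian ring there are finitely many primes not containing `p` such
that an element outside of these primes is a nonzerodivisor modulo `Q` on some power of `p`. -/
theorem exists_finite_primes_nonzerodivisor {S : Type*} [CommRing S] [IsNoetherianRing S]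
    (p Q : Ideal S) :
    ∃ T : Set (Ideal S), T.Finite ∧ (∀ P ∈ T, P.IsPrime ∧ ¬ p ≤ P) ∧
      ∃ n : ℕ, ∀ y : S, (∀ P ∈ T, y ∉ P) → ∀ z ∈ p ^ n, y * z ∈ Q → z ∈ Q := by
  -- The chain `Q : p ^ n` stabilizes at the saturation `Q'`. No associated prime of `S / Q'`
  -- contains `p`: if `p ≤ P = Q' : x`, then `x ∈ Q : p ^ (k + 1) = Q'`.
  let u : ℕ →o Ideal S := ⟨fun n => Q.colon (p ^ n : Ideal S), fun a b h =>
    Submodule.colon_mono le_rfl (Ideal.pow_le_pow_right h)⟩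
  obtain ⟨k, hk⟩ := monotone_stabilizes_iff_noetherian.mpr ‹IsNoetherianRing S› u
  set Q' : Ideal S := u k with hQ'
  have hmem : ∀ n x, x ∈ u n ↔ ∀ w ∈ p ^ n, x * w ∈ Q := fun n x => Submodule.mem_colon
  refine ⟨associatedPrimes S (S ⧸ Q'), associatedPrimes.finite S _, ?_, ?_⟩
  · intro P hP
    have hP' := (isAssociatedPrime_iff.mp hP)
    refine ⟨hP'.1, fun hle => ?_⟩
    obtain ⟨x, hx⟩ := hP'.2
    obtain ⟨x, rfl⟩ := Ideal.Quotient.mk_surjective x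
    have hPx : ∀ w, w ∈ P ↔ w * x ∈ Q' := by
      intro w
      rw [hx, Submodule.mem_colon_singleton, Submodule.mem_bot, ← Ideal.Quotient.eq_zero_iff_mem,
        map_mul, Algebra.smul_def]
      rfl
    have h1 : x ∈ u (k + 1) := by
      rw [hmem]
      intro w hw
      rw [pow_succ'] at hw
      refine Submodule.mul_induction_on hw ?_ ?_
      · intro a ha b hb
        have := (hmem k _).mp ((hPx a).mp (hle ha)) b hb
        convert this using 1
        ring
      · intro a b ha hb
        rw [mul_add]
        exact Q.add_mem ha hb
    rw [← hk (k + 1) (Nat.le_succ k)] at h1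
    apply hP'.1.ne_top
    rw [Ideal.eq_top_iff_one, hPx, one_mul]
    exact h1
  -- By Artin–Rees, `p ^ (n + k) ∩ Q' ≤ p ^ k * Q' ≤ Q`, so in high powers of `p` the saturation is
  -- no larger than `Q`.
  · obtain ⟨n, hn⟩ := Ideal.exists_pow_inf_eq_pow_smul p (M := S) Q'
    refine ⟨n + k, fun y hy z hz hyz => ?_⟩
    have hyQ : y * z ∈ Q' := (hmem k _).mpr fun w _ => Q.mul_mem_right _ hyz
    have hzQ : z ∈ Q' := by
      by_contra hcon
      have hne : (Ideal.Quotient.mk Q' z) ≠ 0 := by rwa [Ne, Ideal.Quotient.eq_zero_iff_mem]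
      have : y ∈ ⋃ P ∈ associatedPrimes S (S ⧸ Q'), (P : Set S) := by
        rw [biUnion_associatedPrimes_eq_zero_divisors]
        refine ⟨_, hne, ?_⟩
        rw [Algebra.smul_def]
        exact Ideal.Quotient.eq_zero_iff_mem.mpr hyQ
      simp only [Set.mem_iUnion] at this
      obtain ⟨P, hP, hyP⟩ := this
      exact hy P hP hyP
    have h2 := hn (n + k) (Nat.le_add_right _ _)
    have h3 : z ∈ (p ^ (n + k) • (⊤ : Submodule S S) ⊓ Q') := ⟨by simpa using hz, hzQ⟩
    rw [h2, Nat.add_sub_cancel_left] at h3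
    have h4 : z ∈ p ^ k * Q' := Submodule.smul_mono le_rfl inf_le_right h3
    refine Submodule.mul_induction_on h4 ?_ ?_
    · intro a ha b hb
      rw [mul_comm]
      exact (hmem k b).mp hb a ha
    · intro a b ha hb
      exact Q.add_mem ha hb

/-- Homogeneous prime avoidance, in all large degrees. -/
theorem exists_forall_notMem_of_graded {S : Type*} [CommRing S] (F : ℕ → AddSubgroup S)
    (hone : 1 ∈ F 0) (hmul : ∀ m n x y, x ∈ F m → y ∈ F n → x * y ∈ F (m + n))
    (T : Finset (Ideal S)) (hT : ∀ P ∈ T, P.IsPrime ∧ ∃ y ∈ F 1, y ∉ P) :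
    ∃ c₀ : ℕ, ∀ c ≥ c₀, ∃ y ∈ F c, ∀ P ∈ T, y ∉ P := by
  classical
  induction hcard : T.card generalizing T with
  | zero =>
    rw [Finset.card_eq_zero] at hcard
    subst hcard
    exact ⟨0, fun c _ => ⟨0, (F c).zero_mem, by simp⟩⟩
  | succ n ih =>
    obtain ⟨P, T, hPT, rfl, hc⟩ := Finset.card_eq_succ.mp hcard
    have hpow : ∀ a ∈ F 1, ∀ k, a ^ k ∈ F k := by
      intro a ha k
      induction k with
      | zero => simpa using hone
      | succ k ihk => rw [pow_succ]; exact hmul _ _ _ _ ihk ha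
    obtain ⟨hP, a, ha, haP⟩ := hT P (Finset.mem_insert_self _ _)
    -- If the homogeneous elements of `P'` all lie in `P`, avoiding `P` on homogeneous elements
    -- already avoids `P'`, which can be dropped.
    by_cases hcase : ∃ P' ∈ T, ∀ n, ∀ y ∈ F n, y ∈ P' → y ∈ P
    · obtain ⟨P', hP', hsub⟩ := hcase
      obtain ⟨c₀, h⟩ := ih (insert P (T.erase P')) (by
        intro Q hQ
        apply hT
        rw [Finset.mem_insert] at hQ ⊢
        exact hQ.imp id (Finset.mem_of_mem_erase)) (by
        rw [Finset.card_insert_of_notMem (fun h => hPT (Finset.mem_of_mem_erase h)),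
          Finset.card_erase_of_mem hP', hc]
        have := Finset.card_pos.mpr ⟨P', hP'⟩
        omega)
      refine ⟨c₀, fun c hcc => ?_⟩
      obtain ⟨y, hy, hyT⟩ := h c hcc
      refine ⟨y, hy, fun Q hQ => ?_⟩
      by_cases hQP' : Q = P'
      · subst hQP'
        exact fun hyQ => hyT P (Finset.mem_insert_self _ _) (hsub c y hy hyQ)
      · apply hyT
        rw [Finset.mem_insert] at hQ ⊢
        exact hQ.imp id (fun h => Finset.mem_erase.mpr ⟨hQP', h⟩)
    · push Not at hcase
      obtain ⟨c₁, h1⟩ := ih T (fun Q hQ => hT Q (Finset.mem_insert_of_mem hQ)) hc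
      -- A homogeneous element in every prime of `T` but not in `P`. Multiplied by a power of `a` to
      -- reach degree `c`, it corrects a `y` lying in `P`.
      have hprod : ∀ U ⊆ T, ∃ N, ∃ w ∈ F N, w ∉ P ∧ ∀ Q ∈ U, w ∈ Q := by
        intro U
        induction U using Finset.induction_on with
        | empty =>
          exact fun _ => ⟨0, 1, hone, fun h => hP.ne_top ((Ideal.eq_top_iff_one _).mpr h), by simp⟩
        | insert Q U hQU ihU =>
          intro hU
          obtain ⟨N, w, hw, hwP, hwU⟩ := ihU fun x hx => hU (Finset.mem_insert_of_mem hx)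
          obtain ⟨N', w', hw', hwQ, hwP'⟩ := hcase Q (hU (Finset.mem_insert_self _ _))
          refine ⟨N + N', w * w', hmul _ _ _ _ hw hw', ?_, ?_⟩
          · intro hmem
            exact (hP.mem_or_mem hmem).elim hwP hwP'
          · intro Q' hQ'
            rcases Finset.mem_insert.mp hQ' with rfl | hQ'
            · exact Ideal.mul_mem_left _ _ hwQ
            · exact Ideal.mul_mem_right _ _ (hwU _ hQ')
      obtain ⟨N, w, hw, hwP, hwT⟩ := hprod T subset_rfl
      refine ⟨max c₁ N, fun c hcc => ?_⟩
      obtain ⟨y, hy, hyT⟩ := h1 c (le_trans (le_max_left _ _) hcc)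
      by_cases hyP : y ∈ P
      · have hNc : N ≤ c := le_trans (le_max_right _ _) hcc
        have hz : w * a ^ (c - N) ∈ F c := by
          have := hmul _ _ _ _ hw (hpow a ha (c - N))
          rwa [Nat.add_sub_cancel' hNc] at this
        have hzP : w * a ^ (c - N) ∉ P := fun hmem =>
          (hP.mem_or_mem hmem).elim hwP fun h => haP (hP.mem_of_pow_mem _ h)
        refine ⟨y + w * a ^ (c - N), (F c).add_mem hy hz, fun Q hQ hmem => ?_⟩
        rcases Finset.mem_insert.mp hQ with rfl | hQ
        · exact hzP ((Ideal.add_mem_iff_right _ hyP).mp hmem)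
        · exact hyT Q hQ
            ((Ideal.add_mem_iff_left _ (Ideal.mul_mem_right _ _ (hwT Q hQ))).mp hmem)
      · refine ⟨y, hy, fun Q hQ => ?_⟩
        rcases Finset.mem_insert.mp hQ with rfl | hQ
        · exact hyP
        · exact hyT Q hQ

/-! ### The bigraded Rees algebra -/

section BigradedRees

variable {R : Type*} [CommRing R] (I J : Ideal R)

/-- The extension of `I` to the Rees algebra of `J`. -/
noncomputable abbrev extendedIdeal : Ideal (reesAlgebra J) :=
  I.map (algebraMap R (reesAlgebra J))

/-- The bigraded Rees algebra `⨁ I ^ r J ^ s`, as an iterated Rees algebra. -/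
def BiRees : Type _ := reesAlgebra (extendedIdeal I J)

noncomputable instance : CommRing (BiRees I J) :=
  inferInstanceAs (CommRing (reesAlgebra (extendedIdeal I J)))

instance [IsNoetherianRing R] : IsNoetherianRing (BiRees I J) :=
  inferInstanceAs (IsNoetherianRing (reesAlgebra (extendedIdeal I J)))

variable {I J}

theorem coeff_mem_of_mem_extendedIdeal_pow {r : ℕ} {b : reesAlgebra J}
    (hb : b ∈ extendedIdeal I J ^ r) (s : ℕ) : b.1.coeff s ∈ I ^ r * J ^ s := by
  rw [extendedIdeal, ← Ideal.map_pow] at hb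
  induction hb using Submodule.span_induction generalizing s with
  | mem x hx =>
    obtain ⟨a, ha, rfl⟩ := hx
    change ((algebraMap R (Polynomial R)) a).coeff s ∈ _
    rw [Polynomial.algebraMap_apply, Polynomial.coeff_C]
    split_ifs with h
    · subst h
      simpa using ha
    · exact Ideal.zero_mem _
  | zero => simp
  | add x y _ _ hx hy =>
    change (x.1 + y.1).coeff s ∈ _
    rw [Polynomial.coeff_add]
    exact Ideal.add_mem _ (hx s) (hy s)
  | smul a x _ hx =>
    change (a.1 * x.1).coeff s ∈ _
    rw [Polynomial.coeff_mul]
    refine Ideal.sum_mem _ fun ij hij => ?_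
    rw [← Finset.HasAntidiagonal.mem_antidiagonal.mp hij, pow_add, mul_left_comm]
    exact Ideal.mul_mem_mul (a.2 _) (hx _)

/-- The coefficient of bidegree `(r, s)`. -/
noncomputable def biCoeff (p : BiRees I J) (r s : ℕ) : R := (p.1.coeff r).1.coeff s

theorem biCoeff_mem (p : BiRees I J) (r s : ℕ) : biCoeff p r s ∈ I ^ r * J ^ s :=
  coeff_mem_of_mem_extendedIdeal_pow (p.2 r) s

theorem biCoeff_add (p q : BiRees I J) (r s : ℕ) :
    biCoeff (p + q) r s = biCoeff p r s + biCoeff q r s := by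
  change ((p.1 + q.1).coeff r).1.coeff s = _
  rw [Polynomial.coeff_add]
  exact Polynomial.coeff_add _ _ _

theorem biCoeff_mul (p q : BiRees I J) (r s : ℕ) :
    biCoeff (p * q) r s = ∑ a ∈ Finset.HasAntidiagonal.antidiagonal r, ∑ b ∈ Finset.HasAntidiagonal.antidiagonal s,
      biCoeff p a.1 b.1 * biCoeff q a.2 b.2 := by
  change ((p.1 * q.1).coeff r).1.coeff s = _
  rw [Polynomial.coeff_mul, AddSubmonoidClass.coe_finsetSum, Polynomial.finsetSum_coeff]
  refine Finset.sum_congr rfl fun a _ => ?_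
  exact Polynomial.coeff_mul _ _ _

variable (I J) in
/-- The ideal of the bigraded Rees algebra with component `K I ^ r J ^ s + 𝔞` in
degree `(r, s)`. -/
def biReesIdeal (K 𝔞 : Ideal R) : Ideal (BiRees I J) where
  carrier := {p | ∀ r s, biCoeff p r s ∈ K * (I ^ r * J ^ s) ⊔ 𝔞}
  add_mem' hp hq r s := by
    rw [biCoeff_add]
    exact Ideal.add_mem _ (hp r s) (hq r s)
  zero_mem' r s := by
    change ((0 : Polynomial (reesAlgebra J)).coeff r).1.coeff s ∈ _
    simp
  smul_mem' q p hp r s := by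
    rw [smul_eq_mul, biCoeff_mul]
    refine Ideal.sum_mem _ fun a ha => Ideal.sum_mem _ fun b hb => ?_
    rw [← Finset.HasAntidiagonal.mem_antidiagonal.mp ha, ← Finset.HasAntidiagonal.mem_antidiagonal.mp hb]
    have h := Ideal.mul_mem_mul (biCoeff_mem q a.1 b.1) (hp a.2 b.2)
    refine SetLike.le_def.mp ?_ h
    rw [Ideal.mul_sup]
    refine sup_le_sup (le_of_eq ?_) Ideal.mul_le_right
    ring

variable (I J) in
/-- The monomials `a t ^ n` with `a ∈ I ^ n`. -/
noncomputable def biReesHom (n : ℕ) : AddSubgroup (BiRees I J) where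
  carrier := {p | ∃ a ∈ I ^ n, p.1 = Polynomial.monomial n (algebraMap R _ a)}
  add_mem' := by
    rintro p q ⟨a, ha, hp⟩ ⟨b, hb, hq⟩
    exact ⟨a + b, Ideal.add_mem _ ha hb, by rw [map_add, map_add, ← hp, ← hq]; rfl⟩
  zero_mem' := ⟨0, Ideal.zero_mem _, by rw [map_zero, map_zero]; rfl⟩
  neg_mem' := by
    rintro p ⟨a, ha, hp⟩
    exact ⟨-a, Ideal.neg_mem_iff _ |>.mpr ha, by rw [map_neg, map_neg, ← hp]; rfl⟩

variable (I J) in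
/-- The ideal of elements of positive degree in the first grading. -/
noncomputable def biReesIrrelevant : Ideal (BiRees I J) := Ideal.span (biReesHom I J 1 : Set _)

theorem exists_mem_biReesHom {n : ℕ} {a : R} (ha : a ∈ I ^ n) :
    ∃ p ∈ biReesHom I J n, p.1 = Polynomial.monomial n (algebraMap R _ a) := by
  refine ⟨⟨Polynomial.monomial n (algebraMap R _ a), reesAlgebra.monomial_mem.mpr ?_⟩,
    ⟨a, ha, rfl⟩, rfl⟩
  rw [extendedIdeal, ← Ideal.map_pow]
  exact Ideal.mem_map_of_mem _ ha

theorem biReesHom_mul (m n : ℕ) (p q : BiRees I J) (hp : p ∈ biReesHom I J m)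
    (hq : q ∈ biReesHom I J n) : p * q ∈ biReesHom I J (m + n) := by
  obtain ⟨a, ha, hp⟩ := hp
  obtain ⟨b, hb, hq⟩ := hq
  refine ⟨a * b, by rw [pow_add]; exact Ideal.mul_mem_mul ha hb, ?_⟩
  change p.1 * q.1 = _
  rw [hp, hq, Polynomial.monomial_mul_monomial, (algebraMap R (reesAlgebra J)).map_mul]

theorem biReesHom_le_irrelevant_pow (n : ℕ) (p : BiRees I J) (hp : p ∈ biReesHom I J n) :
    p ∈ biReesIrrelevant I J ^ n := by
  have key : ∀ n, ∀ a ∈ I ^ n, ∃ q ∈ biReesIrrelevant I J ^ n,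
      q.1 = Polynomial.monomial n (algebraMap R (reesAlgebra J) a) := by
    intro n
    induction n with
    | zero =>
      intro a ha
      obtain ⟨q, -, hq⟩ := exists_mem_biReesHom (J := J) ha
      exact ⟨q, by simp, hq⟩
    | succ n ih =>
      intro a ha
      rw [pow_succ] at ha
      refine Submodule.mul_induction_on ha ?_ ?_
      · intro b hb c hc
        obtain ⟨q, hq, hq'⟩ := ih b hb
        obtain ⟨w, hw, hw'⟩ := exists_mem_biReesHom (I := I) (J := J) (n := 1) (a := c)
          (by rwa [pow_one])
        refine ⟨q * w, ?_, ?_⟩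
        · rw [pow_succ]
          exact Ideal.mul_mem_mul hq (Ideal.subset_span hw)
        · change q.1 * w.1 = _
          rw [hq', hw', Polynomial.monomial_mul_monomial,
            (algebraMap R (reesAlgebra J)).map_mul]
      · rintro b c ⟨q, hq, hq'⟩ ⟨w, hw, hw'⟩
        refine ⟨q + w, Ideal.add_mem _ hq hw, ?_⟩
        change q.1 + w.1 = _
        rw [hq', hw', map_add, map_add]
  obtain ⟨a, ha, hp⟩ := hp
  obtain ⟨q, hq, hq'⟩ := key n a ha
  rwa [show p = q from Subtype.ext (hp.trans hq'.symm)]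

theorem exists_biMonomial {r s : ℕ} {x : R} (hx : x ∈ I ^ r * J ^ s) :
    ∃ p ∈ biReesIrrelevant I J ^ r, ∃ b : reesAlgebra J, p.1 = Polynomial.monomial r b ∧
      b.1 = Polynomial.monomial s x := by
  refine Submodule.mul_induction_on hx ?_ ?_
  · intro a ha b hb
    obtain ⟨q, hq, hq'⟩ := exists_mem_biReesHom (J := J) ha
    let w : reesAlgebra J := ⟨Polynomial.monomial s b, reesAlgebra.monomial_mem.mpr hb⟩
    let w' : BiRees I J := ⟨Polynomial.monomial 0 w, reesAlgebra.monomial_mem.mpr (by simp)⟩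
    refine ⟨q * w', Ideal.mul_mem_right _ _ (biReesHom_le_irrelevant_pow r q hq),
      algebraMap R _ a * w, ?_, ?_⟩
    · change q.1 * w'.1 = _
      rw [hq', Polynomial.monomial_mul_monomial, add_zero]
    · change (algebraMap R (Polynomial R)) a * Polynomial.monomial s b = _
      rw [Polynomial.algebraMap_apply, Algebra.algebraMap_self_apply, Polynomial.C_mul_monomial]
  · rintro a b ⟨p, hp, a', hpa, ha⟩ ⟨q, hq, b', hqb, hb⟩
    refine ⟨p + q, Ideal.add_mem _ hp hq, a' + b', ?_, ?_⟩
    · change p.1 + q.1 = _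
      rw [hpa, hqb, map_add]
    · change a'.1 + b'.1 = _
      rw [ha, hb, map_add]

/-- A monomial of bidegree `(r, s)` lies in the `r`-th power of the irrelevant ideal. So for large
`r` the nonzerodivisor property modulo `biReesIdeal I J K 𝔞` can be read off in a single bidegree,
and the bound on `r` does not depend on `s`. -/
theorem exists_finite_primes_cancel [IsNoetherianRing R] (K 𝔞 : Ideal R) :
    ∃ T : Set (Ideal (BiRees I J)), T.Finite ∧
      (∀ P ∈ T, P.IsPrime ∧ ¬ biReesIrrelevant I J ≤ P) ∧ ∃ n : ℕ,
        ∀ c f, ∀ y : BiRees I J, y.1 = Polynomial.monomial c (algebraMap R _ f) →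
          (∀ P ∈ T, y ∉ P) → ∀ r ≥ n, ∀ s, ∀ x ∈ I ^ r * J ^ s,
            x * f ∈ K * (I ^ (r + c) * J ^ s) ⊔ 𝔞 → x ∈ K * (I ^ r * J ^ s) ⊔ 𝔞 := by
  obtain ⟨T, hfin, hT, n, hn⟩ := exists_finite_primes_nonzerodivisor (biReesIrrelevant I J)
    (biReesIdeal I J K 𝔞)
  refine ⟨T, hfin, hT, n, fun c f y hy hyT r hr s x hx hxf => ?_⟩
  obtain ⟨z, hz, b, hzb, hb⟩ := exists_biMonomial hx
  have h := hn y hyT z (Ideal.pow_le_pow_right hr hz) ?_ r s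
  · rw [biCoeff, hzb, Polynomial.coeff_monomial, if_pos rfl, hb, Polynomial.coeff_monomial,
      if_pos rfl] at h
    exact h
  · intro r' s'
    have hval : biCoeff (y * z) r' s' = ((Polynomial.monomial (c + r) (algebraMap R _ f * b) :
        Polynomial (reesAlgebra J)).coeff r').1.coeff s' := by
      change ((y.1 * z.1).coeff r').1.coeff s' = _
      rw [hy, hzb, Polynomial.monomial_mul_monomial]
    rw [hval, Polynomial.coeff_monomial]
    split_ifs with h1
    · subst h1
      change ((algebraMap R (Polynomial R)) f * b.1).coeff s' ∈ _
      rw [hb, Polynomial.algebraMap_apply, Algebra.algebraMap_self_apply,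
        Polynomial.C_mul_monomial, Polynomial.coeff_monomial]
      split_ifs with h2
      · subst h2
        rwa [mul_comm f x, add_comm c r]
      · exact Ideal.zero_mem _
    · exact Ideal.zero_mem _

end BigradedRees

/-! ### Superficial elements -/

/-- `f ∈ I ^ c` is superficial of degree `c` for `I` and `J`, relative to the ideal `𝔞`, from the
`r₀`-th power of `I` on. -/
structure IsSuperficial {R : Type*} [CommRing R] (I J 𝔞 : Ideal R) (r₀ c : ℕ) (f : R) : Prop where
  mem : f ∈ I ^ c
  mem_of_mul_mem : ∀ r ≥ r₀, ∀ s, ∀ x ∈ I ^ r₀ ⊔ 𝔞,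
    x * f ∈ I ^ (r + c) * J ^ s ⊔ 𝔞 → x ∈ I ^ r * J ^ s ⊔ 𝔞
  mem_of_mul_mem_base : ∀ x ∈ I ^ r₀ ⊔ 𝔞, x * f ∈ 𝔞 → x ∈ 𝔞

/-- Superficial elements exist in all large degrees. -/
theorem exists_isSuperficial {R : Type*} [CommRing R] [IsNoetherianRing R] (I J 𝔞 : Ideal R) :
    ∃ c₀ r₀ : ℕ, ∀ c ≥ c₀, ∃ f, IsSuperficial I J 𝔞 r₀ c f := by
  classical
  -- Taking `K` to be `I`, `J` and `⊥` serves to raise the exponent of `I`, to raise that of `J`,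
  -- and to cancel modulo `𝔞` itself.
  obtain ⟨T₁, hf₁, hT₁, n₁, hn₁⟩ := exists_finite_primes_cancel (I := I) (J := J) I 𝔞
  obtain ⟨T₂, hf₂, hT₂, n₂, hn₂⟩ := exists_finite_primes_cancel (I := I) (J := J) J 𝔞
  obtain ⟨T₃, hf₃, hT₃, n₃, hn₃⟩ := exists_finite_primes_cancel (I := I) (J := J) ⊥ 𝔞
  have hT : ∀ P ∈ T₁ ∪ T₂ ∪ T₃, P.IsPrime ∧ ¬ biReesIrrelevant I J ≤ P := by
    rintro P ((h | h) | h)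
    · exact hT₁ P h
    · exact hT₂ P h
    · exact hT₃ P h
  obtain ⟨c₀, hc₀⟩ := exists_forall_notMem_of_graded (biReesHom I J)
    ⟨1, by simp, by rw [map_one]; rfl⟩ biReesHom_mul ((hf₁.union hf₂).union hf₃).toFinset (by
      intro P hP
      obtain ⟨hP, hle⟩ := hT P ((Set.Finite.mem_toFinset _).mp hP)
      refine ⟨hP, ?_⟩
      rw [biReesIrrelevant, Ideal.span_le, Set.not_subset] at hle
      exact hle)
  refine ⟨c₀, max n₁ (max n₂ n₃), fun c hc => ?_⟩
  set r₀ := max n₁ (max n₂ n₃) with hr₀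
  have h1 : n₁ ≤ r₀ := le_max_left _ _
  have h2 : n₂ ≤ r₀ := (le_max_left _ _).trans (le_max_right _ _)
  have h3 : n₃ ≤ r₀ := (le_max_right _ _).trans (le_max_right _ _)
  clear_value r₀
  obtain ⟨y, ⟨f, hf, hyf⟩, hy⟩ := hc₀ c hc
  have hy' : ∀ P ∈ T₁ ∪ T₂ ∪ T₃, y ∉ P := fun P hP => hy P ((Set.Finite.mem_toFinset _).mpr hP)
  have k1 := hn₁ c f y hyf fun P hP => hy' P (Or.inl (Or.inl hP))
  have k2 := hn₂ c f y hyf fun P hP => hy' P (Or.inl (Or.inr hP))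
  have k3 := hn₃ c f y hyf fun P hP => hy' P (Or.inr hP)
  refine ⟨f, hf, ?_, ?_⟩
  · intro r hr s x hx hxf
    obtain ⟨x, hx', a, ha, rfl⟩ := Submodule.mem_sup.mp hx
    clear hx
    rw [add_mul] at hxf
    replace hxf := (Ideal.add_mem_iff_left _
      (Ideal.mem_sup_right (Ideal.mul_mem_right _ _ ha))).mp hxf
    refine Ideal.add_mem _ ?_ (Ideal.mem_sup_right ha)
    -- Membership is improved one factor at a time: first up to `I ^ r` with `s = 0`, then through
    -- the powers of `J`.
    have step1 : ∀ i, r₀ + i ≤ r → x ∈ I ^ (r₀ + i) ⊔ 𝔞 := by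
      intro i
      induction i with
      | zero => exact fun _ => Ideal.mem_sup_left hx'
      | succ i ih =>
        intro hi
        obtain ⟨u, hu, v, hv, huv⟩ := Submodule.mem_sup.mp (ih (by omega))
        have huf : u * f ∈ I ^ (r + c) * J ^ s ⊔ 𝔞 := by
          rw [← huv, add_mul] at hxf
          exact (Ideal.add_mem_iff_left _
            (Ideal.mem_sup_right (Ideal.mul_mem_right _ _ hv))).mp hxf
        have := k1 (r₀ + i) (by omega) 0 u (by simpa using hu) (by
          refine SetLike.le_def.mp (sup_le_sup_right ?_ 𝔞) huf
          rw [pow_zero, mul_one, ← pow_succ']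
          exact Ideal.mul_le_left.trans (Ideal.pow_le_pow_right (by omega)))
        rw [pow_zero, mul_one, ← pow_succ'] at this
        rw [← huv]
        exact Ideal.add_mem _ this (Ideal.mem_sup_right hv)
    have step2 : ∀ i ≤ s, x ∈ I ^ r * J ^ i ⊔ 𝔞 := by
      intro i
      induction i with
      | zero =>
        intro _
        have := step1 (r - r₀) (by omega)
        rwa [Nat.add_sub_cancel' hr, ← mul_one (I ^ r), ← pow_zero J] at this
      | succ i ih =>
        intro hi
        obtain ⟨u, hu, v, hv, huv⟩ := Submodule.mem_sup.mp (ih (by omega))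
        have huf : u * f ∈ I ^ (r + c) * J ^ s ⊔ 𝔞 := by
          rw [← huv, add_mul] at hxf
          exact (Ideal.add_mem_iff_left _
            (Ideal.mem_sup_right (Ideal.mul_mem_right _ _ hv))).mp hxf
        have := k2 r (by omega) i u hu (by
          refine SetLike.le_def.mp (sup_le_sup_right ?_ 𝔞) huf
          rw [mul_left_comm, ← pow_succ']
          exact Ideal.mul_mono le_rfl (Ideal.pow_le_pow_right hi))
        rw [mul_left_comm, ← pow_succ'] at this
        rw [← huv]
        exact Ideal.add_mem _ this (Ideal.mem_sup_right hv)
    exact step2 s le_rfl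
  · intro x hx hxf
    obtain ⟨x, hx', a, ha, rfl⟩ := Submodule.mem_sup.mp hx
    clear hx
    rw [add_mul] at hxf
    replace hxf := (Ideal.add_mem_iff_left _ (Ideal.mul_mem_right _ _ ha)).mp hxf
    refine Ideal.add_mem _ ?_ ha
    have := k3 r₀ h3 0 x (by simpa using hx') (Ideal.mem_sup_right hxf)
    rwa [Ideal.bot_mul, bot_sup_eq] at this

/-! ### Additivity of colength -/

section Colength

variable {R : Type*} [CommRing R]

/-- The ideal `X` has finite colength. -/
def FiniteColength (X : Ideal R) : Prop := Module.length R (R ⧸ X) ≠ ⊤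

/-- The length of `R / X`, as a natural number. -/
noncomputable def colength (X : Ideal R) : ℕ := (Module.length R (R ⧸ X)).toNat

theorem FiniteColength.coe_colength {X : Ideal R} (h : FiniteColength X) :
    (colength X : ℕ∞) = Module.length R (R ⧸ X) :=
  ENat.natCast_toNat h

theorem length_quotient_antitone {X Y : Ideal R} (h : X ≤ Y) :
    Module.length R (R ⧸ Y) ≤ Module.length R (R ⧸ X) :=
  Module.length_le_of_surjective (Submodule.factor h) (Submodule.factor_surjective h)

theorem FiniteColength.mono {X Y : Ideal R} (hX : FiniteColength X) (h : X ≤ Y) :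
    FiniteColength Y :=
  ne_top_of_le_ne_top hX (length_quotient_antitone h)

theorem colength_antitone {X Y : Ideal R} (hX : FiniteColength X) (h : X ≤ Y) :
    colength Y ≤ colength X :=
  ENat.toNat_le_toNat (length_quotient_antitone h) hX

theorem le_colon_singleton (L : Ideal R) (f : R) : L ≤ L.colon {f} := fun x hx =>
  Submodule.mem_colon_singleton.mpr (by rw [smul_eq_mul]; exact Ideal.mul_mem_right _ _ hx)

/-- Multiplication by `f` gives the exact sequence `0 → R/(L : f) → R/L → R/(L + (f)) → 0`. -/
theorem length_quotient_colon (L : Ideal R) (f : R) :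
    Module.length R (R ⧸ L) =
      Module.length R (R ⧸ L.colon {f}) + Module.length R (R ⧸ (L ⊔ Ideal.span {f})) := by
  let g : R →ₗ[R] R ⧸ L := L.mkQ.comp (LinearMap.mulRight R f)
  have hg : L.colon {f} = LinearMap.ker g := by
    ext x
    rw [Submodule.mem_colon_singleton, LinearMap.mem_ker]
    exact (Submodule.Quotient.mk_eq_zero L).symm
  refine Module.length_eq_add_of_exact ((L.colon {f}).liftQ g hg.le)
    (Submodule.factor (le_sup_left : L ≤ L ⊔ Ideal.span {f})) ?_
    (Submodule.factor_surjective _) ?_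
  · rw [← LinearMap.ker_eq_bot, Submodule.ker_liftQ_eq_bot _ _ _ hg.ge]
  · rw [LinearMap.exact_iff, Submodule.range_liftQ]
    ext y
    obtain ⟨y, rfl⟩ := Submodule.mkQ_surjective L y
    rw [LinearMap.mem_ker, LinearMap.mem_range]
    change Submodule.Quotient.mk y = 0 ↔ ∃ x, Submodule.Quotient.mk (x * f) = Submodule.Quotient.mk y
    rw [Submodule.Quotient.mk_eq_zero]
    constructor
    · intro h
      obtain ⟨l, hl, z, hz, rfl⟩ := Submodule.mem_sup.mp h
      obtain ⟨x, rfl⟩ := Ideal.mem_span_singleton'.mp hz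
      refine ⟨x, (Submodule.Quotient.eq L).mpr ?_⟩
      rw [sub_add_cancel_right]
      exact L.neg_mem hl
    · rintro ⟨x, hx⟩
      rw [Submodule.Quotient.eq] at hx
      have : y = x * f - (x * f - y) := by ring
      rw [this]
      exact Ideal.sub_mem _ (Ideal.mem_sup_right (Ideal.mem_span_singleton'.mpr ⟨x, rfl⟩))
        (Ideal.mem_sup_left hx)

theorem length_quotient_inf_add_sup (X Y : Ideal R) :
    Module.length R (R ⧸ X) + Module.length R (R ⧸ Y) =
      Module.length R (R ⧸ (X ⊓ Y)) + Module.length R (R ⧸ (X ⊔ Y)) := by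
  rw [← Module.length_prod]
  let g : R →ₗ[R] (R ⧸ X) × (R ⧸ Y) := X.mkQ.prod Y.mkQ
  have hg : X ⊓ Y = LinearMap.ker g := by
    change _ = LinearMap.ker (X.mkQ.prod Y.mkQ)
    rw [LinearMap.ker_prod, Submodule.ker_mkQ, Submodule.ker_mkQ]
  refine Module.length_eq_add_of_exact ((X ⊓ Y).liftQ g hg.le)
    ((Submodule.factor (le_sup_left : X ≤ X ⊔ Y)).coprod
      (-(Submodule.factor (le_sup_right : Y ≤ X ⊔ Y)))) ?_ ?_ ?_
  · rw [← LinearMap.ker_eq_bot, Submodule.ker_liftQ_eq_bot _ _ _ hg.ge]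
  · intro y
    obtain ⟨y, rfl⟩ := Submodule.factor_surjective (le_sup_left : X ≤ X ⊔ Y) y
    exact ⟨(y, 0), by simp⟩
  · rw [LinearMap.exact_iff, Submodule.range_liftQ]
    ext ⟨a, b⟩
    obtain ⟨a, rfl⟩ := Submodule.mkQ_surjective X a
    obtain ⟨b, rfl⟩ := Submodule.mkQ_surjective Y b
    rw [LinearMap.mem_ker, LinearMap.mem_range]
    change (Submodule.Quotient.mk a : R ⧸ (X ⊔ Y)) + -(Submodule.Quotient.mk b : R ⧸ (X ⊔ Y)) = 0 ↔
      ∃ x, ((Submodule.Quotient.mk x : R ⧸ X), (Submodule.Quotient.mk x : R ⧸ Y)) =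
        (Submodule.Quotient.mk a, Submodule.Quotient.mk b)
    rw [← sub_eq_add_neg, sub_eq_zero, Submodule.Quotient.eq]
    simp only [Prod.mk.injEq, Submodule.Quotient.eq]
    constructor
    · intro h
      obtain ⟨x, hx, y, hy, hxy⟩ := Submodule.mem_sup.mp h
      refine ⟨a - x, by simpa using hx, ?_⟩
      have : a - x - b = y := by linear_combination -hxy
      rwa [this]
    · rintro ⟨x, h1, h2⟩
      have : a - b = -(x - a) + (x - b) := by ring
      rw [this]
      exact Ideal.add_mem _ (Ideal.mem_sup_left (X.neg_mem h1)) (Ideal.mem_sup_right h2)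

theorem colength_eq_colon_add {L : Ideal R} (hL : FiniteColength L) (f : R) :
    colength L = colength (L.colon {f}) + colength (L ⊔ Ideal.span {f}) := by
  have h := length_quotient_colon L f
  rw [← hL.coe_colength, ← (hL.mono (le_colon_singleton L f)).coe_colength,
    ← (hL.mono le_sup_left).coe_colength] at h
  exact_mod_cast h

theorem colength_add_colength {X Y : Ideal R} (hX : FiniteColength X) (hY : FiniteColength Y) :
    colength X + colength Y = colength (X ⊓ Y) + colength (X ⊔ Y) := by
  have h := length_quotient_inf_add_sup X Y
  have hXY : FiniteColength (X ⊓ Y) := by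
    intro htop
    rw [htop, top_add, ← hX.coe_colength, ← hY.coe_colength] at h
    exact ENat.natCast_ne_top (colength X + colength Y) (by exact_mod_cast h)
  rw [← hX.coe_colength, ← hY.coe_colength, ← hXY.coe_colength,
    ← (hX.mono le_sup_left).coe_colength] at h
  exact_mod_cast h

end Colength

/-! ### Finite colength in a Noetherian local ring -/

section LocalRing

variable {R : Type*} [CommRing R] [IsLocalRing R] [IsNoetherianRing R]

open IsLocalRing

theorem finiteColength_of_pow_le {X : Ideal R} {n : ℕ} (h : maximalIdeal R ^ n ≤ X) :
    FiniteColength X := by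
  have h0 : Ring.KrullDimLE 0 (R ⧸ X) := by
    rw [Ring.krullDimLE_zero_iff]
    intro P hP
    have hle : maximalIdeal R ≤ P.comap (Ideal.Quotient.mk X) := by
      have : (P.comap (Ideal.Quotient.mk X)).IsPrime := Ideal.IsPrime.comap _
      refine this.le_of_pow_le (n := n) (h.trans fun x hx => ?_)
      rw [Ideal.mem_comap, Ideal.Quotient.eq_zero_iff_mem.mpr hx]
      exact P.zero_mem
    have hmax : (P.comap (Ideal.Quotient.mk X)).IsMaximal := by
      rw [← (maximalIdeal.isMaximal R).eq_of_le (Ideal.IsPrime.comap _).ne_top hle]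
      exact maximalIdeal.isMaximal R
    rw [← Ideal.map_comap_of_surjective _ Ideal.Quotient.mk_surjective P]
    refine (Ideal.map_eq_top_or_isMaximal_of_surjective _ Ideal.Quotient.mk_surjective
      hmax).resolve_left ?_
    rw [Ideal.map_comap_of_surjective _ Ideal.Quotient.mk_surjective P]
    exact hP.ne_top
  have h1 : IsArtinianRing (R ⧸ X) := isArtinianRing_iff_krullDimLE_zero.mpr h0
  rw [FiniteColength, Module.length_eq_of_surjective (R := R ⧸ X) (S := R) (M := R ⧸ X)
    Ideal.Quotient.mk_surjective]
  exact Module.length_ne_top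

theorem exists_pow_le_of_radical_eq {I : Ideal R} (hI : I.radical = maximalIdeal R) :
    ∃ n, maximalIdeal R ^ n ≤ I := by
  rw [← hI]
  exact I.exists_radical_pow_le_of_fg (IsNoetherian.noetherian _)

theorem finiteColength_pow_mul_pow {I J : Ideal R} (hI : I.radical = maximalIdeal R)
    (hJ : J.radical = maximalIdeal R) (r s : ℕ) : FiniteColength (I ^ r * J ^ s) := by
  obtain ⟨a, ha⟩ := exists_pow_le_of_radical_eq hI
  obtain ⟨b, hb⟩ := exists_pow_le_of_radical_eq hJ
  apply finiteColength_of_pow_le (n := a * r + b * s)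
  rw [pow_add, pow_mul, pow_mul]
  exact Ideal.mul_mono (Ideal.pow_right_mono ha r) (Ideal.pow_right_mono hb s)

end LocalRing

/-! ### Colength and superficial elements -/

section Superficial

variable {R : Type*} [CommRing R] {I J 𝔞 : Ideal R} {r₀ c : ℕ} {f : R}

theorem IsSuperficial.colon_inf (h : IsSuperficial I J 𝔞 r₀ c f) {r : ℕ} (hr : r₀ ≤ r) (s : ℕ) :
    (I ^ (r + c) * J ^ s ⊔ 𝔞).colon {f} ⊓ (I ^ r₀ ⊔ 𝔞) = I ^ r * J ^ s ⊔ 𝔞 := by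
  refine le_antisymm (fun x hx => h.mem_of_mul_mem r hr s x hx.2
    (Submodule.mem_colon_singleton.mp hx.1)) (le_inf (fun x hx => ?_) ?_)
  · rw [Submodule.mem_colon_singleton, smul_eq_mul]
    obtain ⟨u, hu, v, hv, rfl⟩ := Submodule.mem_sup.mp hx
    rw [add_mul]
    refine Ideal.add_mem _ (Ideal.mem_sup_left ?_) (Ideal.mem_sup_right (Ideal.mul_mem_right _ _ hv))
    rw [pow_add, mul_right_comm]
    exact Ideal.mul_mem_mul hu h.mem
  · exact sup_le_sup_right (Ideal.mul_le_left.trans (Ideal.pow_le_pow_right hr)) _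

/-- Combines the colon sequence for `f` with inclusion–exclusion for the colon ideal and `I ^ r₀ ⊔
𝔞`, whose intersection is `I ^ r * J ^ s ⊔ 𝔞`. The last term is at most the colength of `I ^ r₀ ⊔
𝔞`, so the error is bounded uniformly in `r` and `s`. -/
theorem IsSuperficial.colength_add (h : IsSuperficial I J 𝔞 r₀ c f)
    (hfin : ∀ r s, FiniteColength (I ^ r * J ^ s)) {r : ℕ} (hr : r₀ ≤ r) (s : ℕ) :
    colength (I ^ (r + c) * J ^ s ⊔ 𝔞) + colength (I ^ r₀ ⊔ 𝔞) =
      colength (I ^ r * J ^ s ⊔ 𝔞) + colength (I ^ (r + c) * J ^ s ⊔ (𝔞 ⊔ Ideal.span {f})) +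
        colength ((I ^ (r + c) * J ^ s ⊔ 𝔞).colon {f} ⊔ (I ^ r₀ ⊔ 𝔞)) := by
  have hL : FiniteColength (I ^ r₀ ⊔ 𝔞) := by
    have := (hfin r₀ 0).mono (le_sup_left : _ ≤ _ ⊔ 𝔞)
    simpa using this
  have hX : FiniteColength (I ^ (r + c) * J ^ s ⊔ 𝔞) := (hfin _ _).mono le_sup_left
  have h1 := colength_eq_colon_add hX f
  have h2 := colength_add_colength (hX.mono (le_colon_singleton _ f)) hL
  rw [h.colon_inf hr] at h2
  rw [sup_assoc] at h1
  omega

end Superficial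

/-! ### Superficial elements lower the dimension -/

section Dimension

variable {R : Type*} [CommRing R]

/-- Chains of primes above `𝔞` have length at most `n`. -/
def DimensionLE (n : ℕ) (𝔞 : Ideal R) : Prop :=
  ∀ l : LTSeries (PrimeSpectrum R), 𝔞 ≤ l.head.asIdeal → l.length ≤ n

theorem dimensionLE_of_ringKrullDim_le {n : ℕ} (h : ringKrullDim R ≤ n) (𝔞 : Ideal R) :
    DimensionLE n 𝔞 := fun l _ => by
  have := (Order.LTSeries.length_le_krullDim l).trans h
  exact_mod_cast this

theorem DimensionLE.mono {n m : ℕ} {𝔞 𝔟 : Ideal R} (h : DimensionLE n 𝔞) (hnm : n ≤ m)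
    (hab : 𝔞 ≤ 𝔟) : DimensionLE m 𝔟 :=
  fun l hl => (h l (hab.trans hl)).trans hnm

theorem DimensionLE.sup_span_singleton {n : ℕ} {𝔞 : Ideal R} {f : R}
    (h : DimensionLE (n + 1) 𝔞) (hf : ∀ P ∈ 𝔞.minimalPrimes, f ∉ P) :
    DimensionLE n (𝔞 ⊔ Ideal.span {f}) := by
  intro l hl
  obtain ⟨p, hp, hple⟩ := Ideal.exists_minimalPrimes_le (le_sup_left.trans hl)
  let p' : PrimeSpectrum R := ⟨p, hp.1.1⟩
  have hlt : p' < l.head := by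
    refine lt_of_le_of_ne hple fun heq => hf p hp ?_
    have h1 : f ∈ l.head.asIdeal :=
      hl (Ideal.mem_sup_right (Ideal.mem_span_singleton_self f))
    rwa [← heq] at h1
  have := h (l.cons p' hlt) (by simpa using hp.1.2)
  simpa using this

/-- A minimal prime has the form `P = 𝔞 : e`, and `f ∈ P` means `e f ∈ 𝔞`. For `y ∈ I ^ r₀`,
cancelling `f` from `y e f ∈ 𝔞` gives `y e ∈ 𝔞`, that is `y ∈ P`. -/
theorem IsSuperficial.le_of_mem_minimalPrimes [IsNoetherianRing R] {I J 𝔞 : Ideal R} {r₀ c : ℕ} {f : R}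
    (h : IsSuperficial I J 𝔞 r₀ c f) {P : Ideal R} (hP : P ∈ 𝔞.minimalPrimes) (hf : f ∈ P) :
    I ≤ P := by
  obtain ⟨e, rfl⟩ := Submodule.exists_eq_colon_of_mem_minimalPrimes (N := 𝔞) (x := 1) (by
    rwa [show 𝔞.colon {(1 : R)} = 𝔞 by
      ext; rw [Submodule.mem_colon_singleton, smul_eq_mul, mul_one]])
  rw [Submodule.mem_colon_singleton, smul_eq_mul] at hf
  refine hP.1.1.le_of_pow_le (n := r₀) fun y hy => ?_
  rw [Submodule.mem_colon_singleton, smul_eq_mul]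
  refine h.mem_of_mul_mem_base _ (Ideal.mem_sup_left (Ideal.mul_mem_right _ _ hy)) ?_
  rw [mul_assoc, mul_comm e]
  exact Ideal.mul_mem_left _ _ hf

variable [IsLocalRing R]

open IsLocalRing

theorem dimensionLE_zero_of_maximalIdeal_mem {𝔞 : Ideal R}
    (h : maximalIdeal R ∈ 𝔞.minimalPrimes) : DimensionLE 0 𝔞 := by
  intro l hl
  by_contra hlen
  have hpos : 0 < l.length := by omega
  have hlt : l.head < l.last :=
    l.strictMono (a := 0) (b := Fin.last _) (by rw [Fin.lt_def]; simpa using hpos)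
  have h1 : maximalIdeal R ≤ l.head.asIdeal :=
    h.2 ⟨l.head.isPrime, hl⟩ (le_maximalIdeal l.head.isPrime.ne_top)
  exact absurd ((le_maximalIdeal l.last.isPrime.ne_top).trans h1) (not_le_of_gt hlt)

theorem DimensionLE.exists_pow_le [IsNoetherianRing R] {𝔞 : Ideal R} (h : DimensionLE 0 𝔞) :
    ∃ n, maximalIdeal R ^ n ≤ 𝔞 := by
  refine Ideal.exists_pow_le_of_le_radical_of_fg ?_ (IsNoetherian.noetherian _)
  rw [Ideal.radical_eq_sInf]
  refine le_sInf fun P ⟨hle, hP⟩ => ?_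
  by_contra hcon
  let p : PrimeSpectrum R := ⟨P, hP⟩
  have hlt : p < closedPoint R :=
    lt_of_le_not_ge (le_maximalIdeal hP.ne_top) hcon
  let l : LTSeries (PrimeSpectrum R) := RelSeries.cons (RelSeries.singleton _ (closedPoint R)) p hlt
  have hhead : l.head = p := RelSeries.head_cons _ _ _
  have hlen : l.length = 1 := rfl
  have h1 : l.length ≤ 0 := h l (by rwa [hhead])
  omega

/-- If `f` lies in a minimal prime of `𝔞`, that prime contains `I` and so is the maximal ideal; the
dimension is then already zero. -/
theorem IsSuperficial.dimensionLE [IsNoetherianRing R] {I J 𝔞 : Ideal R} {r₀ c n : ℕ} {f : R}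
    (h : IsSuperficial I J 𝔞 r₀ c f) (hI : I.radical = maximalIdeal R)
    (hdim : DimensionLE (n + 1) 𝔞) : DimensionLE n (𝔞 ⊔ Ideal.span {f}) := by
  by_cases hcase : ∃ P ∈ 𝔞.minimalPrimes, f ∈ P
  · obtain ⟨P, hP, hf⟩ := hcase
    have hle := h.le_of_mem_minimalPrimes hP hf
    have hprime := hP.1.1
    have hle' : maximalIdeal R ≤ P := by
      rw [← hI]
      exact hprime.radical_le_iff.mpr hle
    have heq : P = maximalIdeal R := le_antisymm (le_maximalIdeal hprime.ne_top) hle'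
    subst heq
    exact (dimensionLE_zero_of_maximalIdeal_mem hP).mono (Nat.zero_le _) le_sup_left
  · push Not at hcase
    exact hdim.sup_span_singleton hcase

end Dimension

/-! ### Functions that are eventually polynomial -/

section EventuallyPoly

/-- `H r s` agrees for large `r` and `s` with a polynomial of total degree at most `min n 2`. -/
def EventuallyPoly (n : ℕ) (H : ℕ → ℕ → ℚ) : Prop :=
  ∃ a b c d e g : ℚ, (n < 2 → a = 0 ∧ b = 0 ∧ c = 0) ∧ (n < 1 → d = 0 ∧ e = 0) ∧
    ∃ N : ℕ, ∀ r ≥ N, ∀ s ≥ N,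
      H r s = a * r ^ 2 + b * (r * s) + c * s ^ 2 + d * r + e * s + g

theorem EventuallyPoly.congr {n : ℕ} {H K : ℕ → ℕ → ℚ} (hH : EventuallyPoly n H)
    (h : ∃ N : ℕ, ∀ r ≥ N, ∀ s ≥ N, K r s = H r s) : EventuallyPoly n K := by
  obtain ⟨a, b, c, d, e, g, h2, h1, N, hN⟩ := hH
  obtain ⟨N', hN'⟩ := h
  refine ⟨a, b, c, d, e, g, h2, h1, max N N', fun r hr s hs => ?_⟩
  rw [hN' r (by omega) s (by omega), hN r (by omega) s (by omega)]

theorem EventuallyPoly.add_mul {n : ℕ} {H K : ℕ → ℕ → ℚ} (hH : EventuallyPoly n H)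
    (hK : EventuallyPoly n K) (t : ℚ) : EventuallyPoly n (fun r s => H r s + t * K r s) := by
  obtain ⟨a, b, c, d, e, g, h2, h1, N, hN⟩ := hH
  obtain ⟨a', b', c', d', e', g', h2', h1', N', hN'⟩ := hK
  refine ⟨a + t * a', b + t * b', c + t * c', d + t * d', e + t * e', g + t * g', ?_, ?_,
    max N N', fun r hr s hs => ?_⟩
  · intro hn
    obtain ⟨rfl, rfl, rfl⟩ := h2 hn
    obtain ⟨rfl, rfl, rfl⟩ := h2' hn
    simp
  · intro hn
    obtain ⟨rfl, rfl⟩ := h1 hn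
    obtain ⟨rfl, rfl⟩ := h1' hn
    simp
  · simp only [hN r (by omega) s (by omega), hN' r (by omega) s (by omega)]
    ring

theorem EventuallyPoly.shift {n : ℕ} {H K : ℕ → ℕ → ℚ} (hH : EventuallyPoly n H) (k l : ℕ)
    (h : ∃ N : ℕ, ∀ r ≥ N, ∀ s ≥ N, K (r + l) s = H (r + k) s) : EventuallyPoly n K := by
  obtain ⟨a, b, c, d, e, g, h2, h1, N, hN⟩ := hH
  obtain ⟨N', hN'⟩ := h
  set t : ℚ := (k : ℚ) - l with ht
  refine ⟨a, b, c, d + 2 * a * t, e + b * t, g + a * t ^ 2 + d * t, h2, ?_, N + N' + l,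
    fun r hr s hs => ?_⟩
  · intro hn
    obtain ⟨rfl, rfl⟩ := h1 hn
    obtain ⟨rfl, rfl, rfl⟩ := h2 (by omega)
    simp
  · obtain ⟨r, rfl⟩ := Nat.exists_eq_add_of_le' (show l ≤ r by omega)
    rw [hN' r (by omega) s (by omega), hN (r + k) (by omega) s (by omega), ht]
    push_cast
    ring

theorem EventuallyPoly.swap {n : ℕ} {H : ℕ → ℕ → ℚ} (hH : EventuallyPoly n H) :
    EventuallyPoly n (fun r s => H s r) := by
  obtain ⟨a, b, c, d, e, g, h2, h1, N, hN⟩ := hH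
  refine ⟨c, b, a, e, d, g, fun hn => ?_, fun hn => (h1 hn).symm, N, fun r hr s hs => ?_⟩
  · obtain ⟨h, h', h''⟩ := h2 hn
    exact ⟨h'', h', h⟩
  · simp only [hN s hs r hr]
    ring

theorem EventuallyPoly.const (n : ℕ) (t : ℚ) : EventuallyPoly n (fun _ _ => t) :=
  ⟨0, 0, 0, 0, 0, t, by simp, by simp, 0, by simp⟩

theorem EventuallyPoly.of_differences {n : ℕ} (hn : n < 2) {H : ℕ → ℕ → ℚ}
    (h1 : EventuallyPoly n fun r s => H (r + 1) s - H r s)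
    (h2 : EventuallyPoly n fun r s => H r (s + 1) - H r s) : EventuallyPoly (n + 1) H := by
  obtain ⟨a, b, c, d, e, g, h, hl, N, hN⟩ := h1
  obtain ⟨a', b', c', d', e', g', h', hl', N', hN'⟩ := h2
  obtain ⟨rfl, rfl, rfl⟩ := h hn
  obtain ⟨rfl, rfl, rfl⟩ := h' hn
  simp only [zero_mul, zero_add] at hN hN'
  set M := max N N' with hM
  -- The mixed second difference, computed in both orders.
  have hde : e = d' := by
    have e1 := hN M (by omega) M (by omega)
    have e2 := hN M (by omega) (M + 1) (by omega)
    have e3 := hN' M (by omega) M (by omega)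
    have e4 := hN' (M + 1) (by omega) M (by omega)
    push_cast at e2 e4
    linarith
  subst hde
  let Q : ℕ → ℕ → ℚ := fun r s => d / 2 * r ^ 2 + e * (r * s) + e' / 2 * s ^ 2 +
    (g - d / 2) * r + (g' - e' / 2) * s
  have hr : ∀ i j, H (M + i) (M + j) - Q (M + i) (M + j) = H M (M + j) - Q M (M + j) := by
    intro i j
    induction i with
    | zero => rfl
    | succ i ih =>
      have e1 := hN (M + i) (by omega) (M + j) (by omega)
      rw [← ih, ← add_assoc]
      simp only [Q]
      push_cast at e1 ⊢
      linear_combination e1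
  have hs : ∀ j, H M (M + j) - Q M (M + j) = H M M - Q M M := by
    intro j
    induction j with
    | zero => rfl
    | succ j ih =>
      have e1 := hN' M (by omega) (M + j) (by omega)
      rw [← ih, ← add_assoc]
      simp only [Q]
      push_cast at e1 ⊢
      linear_combination e1
  refine ⟨d / 2, e, e' / 2, g - d / 2, g' - e' / 2, H M M - Q M M, ?_, ?_, M, ?_⟩
  · intro hn1
    obtain ⟨rfl, rfl⟩ := hl (by omega)
    obtain ⟨-, rfl⟩ := hl' (by omega)
    simp
  · intro hn1
    omega
  · intro r hr' s hs'
    obtain ⟨i, rfl⟩ := Nat.exists_eq_add_of_le hr'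
    obtain ⟨j, rfl⟩ := Nat.exists_eq_add_of_le hs'
    rw [← hs j, ← hr i j]
    simp only [Q]
    ring

/-- A monotone bounded function of two variables is eventually constant. -/
theorem exists_forall_eq_of_monotone_of_bounded {u : ℕ → ℕ → ℕ}
    (hu : ∀ r r' s s', r ≤ r' → s ≤ s' → u r s ≤ u r' s') {B : ℕ} (hB : ∀ r s, u r s ≤ B) :
    ∃ N t : ℕ, ∀ r ≥ N, ∀ s ≥ N, u r s = t := by
  have hbdd : (Set.range fun n => u n n).Finite :=
    (Set.finite_Iic B).subset (by rintro _ ⟨n, rfl⟩; exact hB n n)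
  obtain ⟨_, ⟨N, rfl⟩, hN⟩ := hbdd.exists_maximal (Set.range_nonempty _)
  refine ⟨N, u N N, fun r hr s hs => le_antisymm ?_ (hu _ _ _ _ hr hs)⟩
  have h1 : u N N ≤ u (max r s) (max r s) := hu _ _ _ _ (by omega) (by omega)
  exact (hu _ _ _ _ (le_max_left r s) (le_max_right r s)).trans
    (hN ⟨max r s, rfl⟩ h1)

end EventuallyPoly

/-! ### Existence of the Bhattacharya polynomial -/

theorem pow_mul_pow_le {R : Type*} [CommRing R] {I J : Ideal R} {r r' s s' : ℕ} (hr : r ≤ r') (hs : s ≤ s') :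
    I ^ r' * J ^ s' ≤ I ^ r * J ^ s :=
  Ideal.mul_mono (Ideal.pow_le_pow_right hr) (Ideal.pow_le_pow_right hs)

section Bhattacharya

variable {R : Type*} [CommRing R] [IsLocalRing R] [IsNoetherianRing R]

open IsLocalRing

theorem eventuallyPoly_difference {n : ℕ} {I J 𝔞 : Ideal R} (hI : I.radical = maximalIdeal R)
    (hJ : J.radical = maximalIdeal R) (h𝔞 : DimensionLE (n + 1) 𝔞)
    (ih : ∀ 𝔟 : Ideal R, DimensionLE n 𝔟 →
      EventuallyPoly n fun r s => colength (I ^ r * J ^ s ⊔ 𝔟)) :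
    EventuallyPoly n fun r s =>
      (colength (I ^ (r + 1) * J ^ s ⊔ 𝔞) : ℚ) - colength (I ^ r * J ^ s ⊔ 𝔞) := by
  have hfin := finiteColength_pow_mul_pow hI hJ
  obtain ⟨c₀, r₀, hsup⟩ := exists_isSuperficial I J 𝔞
  have step : ∀ c ≥ c₀, EventuallyPoly n fun r s =>
      (colength (I ^ (r + c) * J ^ s ⊔ 𝔞) : ℚ) - colength (I ^ r * J ^ s ⊔ 𝔞) := by
    intro c hc
    obtain ⟨f, hf⟩ := hsup c hc
    have hL : FiniteColength (I ^ r₀ ⊔ 𝔞) := by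
      have := (hfin r₀ 0).mono (le_sup_left : _ ≤ _ ⊔ 𝔞)
      simpa using this
    -- The error term decreases as the ideals grow and is bounded by the colength of `I ^ r₀ ⊔ 𝔞`,
    -- so it is eventually a constant `t`.
    obtain ⟨N, t, hNt⟩ := exists_forall_eq_of_monotone_of_bounded
      (u := fun r s => colength ((I ^ (r + c) * J ^ s ⊔ 𝔞).colon {f} ⊔ (I ^ r₀ ⊔ 𝔞)))
      (fun r r' s s' hr hs => colength_antitone (hL.mono le_sup_right)
        (sup_le_sup_right (Submodule.colon_mono
          (sup_le_sup_right (pow_mul_pow_le (by omega) hs) _) le_rfl) _))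
      (fun r s => colength_antitone hL le_sup_right)
    have h1 := ih _ (hf.dimensionLE hI h𝔞)
    have h2 : EventuallyPoly n fun r s =>
        (colength (I ^ (r + c) * J ^ s ⊔ (𝔞 ⊔ Ideal.span {f})) : ℚ) :=
      h1.shift c 0 ⟨0, fun r _ s _ => rfl⟩
    refine (h2.add_mul (EventuallyPoly.const n ((t : ℚ) - colength (I ^ r₀ ⊔ 𝔞))) 1).congr
      ⟨max N r₀, fun r hr s hs => ?_⟩
    have h3 := hf.colength_add hfin (r := r) (by omega) s
    have h4 := hNt r (by omega) s (by omega)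
    rw [h4] at h3
    have h5 : (colength (I ^ (r + c) * J ^ s ⊔ 𝔞) : ℚ) + colength (I ^ r₀ ⊔ 𝔞) =
      colength (I ^ r * J ^ s ⊔ 𝔞) + colength (I ^ (r + c) * J ^ s ⊔ (𝔞 ⊔ Ideal.span {f})) + t := by
      exact_mod_cast h3
    linarith
  -- Superficial elements need not exist in degree 1. Subtracting the difference of step `c₀` from
  -- that of step `c₀ + 1` leaves a unit difference, shifted by `c₀`.
  refine ((step (c₀ + 1) (by omega)).add_mul (step c₀ le_rfl) (-1)).shift 0 c₀
    ⟨0, fun r _ s _ => ?_⟩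
  simp only [add_zero]
  rw [show r + c₀ + 1 = r + (c₀ + 1) by ring]
  ring

/-- Carrying `𝔞` along lets the induction on dimension run inside `R` instead of through quotient
rings. -/
theorem eventuallyPoly_colength (n : ℕ) (hn : n ≤ 2) {I J : Ideal R}
    (hI : I.radical = maximalIdeal R) (hJ : J.radical = maximalIdeal R) (𝔞 : Ideal R)
    (h𝔞 : DimensionLE n 𝔞) : EventuallyPoly n fun r s => colength (I ^ r * J ^ s ⊔ 𝔞) := by
  induction n generalizing I J 𝔞 with
  | zero =>
    obtain ⟨k, hk⟩ := h𝔞.exists_pow_le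
    have hfin := finiteColength_of_pow_le hk
    obtain ⟨N, t, hN⟩ := exists_forall_eq_of_monotone_of_bounded
      (u := fun r s => colength (I ^ r * J ^ s ⊔ 𝔞))
      (fun r r' s s' hr hs => colength_antitone (hfin.mono le_sup_right)
        (sup_le_sup_right (pow_mul_pow_le hr hs) _))
      (fun r s => colength_antitone hfin le_sup_right)
    exact (EventuallyPoly.const 0 (t : ℚ)).congr ⟨N, fun r hr s hs => by
      exact_mod_cast hN r hr s hs⟩
  | succ n ih =>
    refine EventuallyPoly.of_differences (by omega)
      (eventuallyPoly_difference hI hJ h𝔞 fun 𝔟 h𝔟 => ih (by omega) hI hJ 𝔟 h𝔟) ?_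
    have := (eventuallyPoly_difference hJ hI h𝔞 fun 𝔟 h𝔟 => ih (by omega) hJ hI 𝔟 h𝔟).swap
    simpa only [mul_comm] using this

end Bhattacharya

/-! ### Inequalities between quadratic polynomials -/

section Quadratics

theorem leadingCoeff_le_of_eventually_le {a b c a' b' c' : ℚ} {N : ℕ}
    (h : ∀ n : ℕ, N ≤ n → a * n ^ 2 + b * n + c ≤ a' * n ^ 2 + b' * n + c') : a ≤ a' := by
  by_contra! hlt
  obtain ⟨n, hn⟩ := exists_nat_gt ((|b' - b| + |c' - c|) / (a - a'))
  set k := n + N + 1 with hk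
  have hpos : 0 < a - a' := sub_pos.mpr hlt
  have hk1 : (1 : ℚ) ≤ k := by exact_mod_cast (by omega : 1 ≤ k)
  have hnk : (n : ℚ) ≤ k := by exact_mod_cast (by omega : n ≤ k)
  have h1 := h k (by omega)
  rw [div_lt_iff₀ hpos] at hn
  have h2 : |b' - b| + |c' - c| < k * (a - a') :=
    hn.trans_le (mul_le_mul_of_nonneg_right hnk hpos.le)
  have h3 : (b' - b) * k ≤ |b' - b| * k :=
    mul_le_mul_of_nonneg_right (le_abs_self _) (by linarith)
  have h4 : c' - c ≤ |c' - c| * k := by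
    have := mul_le_mul_of_nonneg_left hk1 (abs_nonneg (c' - c))
    linarith [le_abs_self (c' - c)]
  have h5 := mul_lt_mul_of_pos_right h2 (by linarith : (0 : ℚ) < k)
  nlinarith

theorem nonneg_of_eventually_nonneg {b c : ℚ} {N : ℕ}
    (h : ∀ n : ℕ, N ≤ n → 0 ≤ b * n + c) : 0 ≤ b := by
  refine leadingCoeff_le_of_eventually_le (a := 0) (b := 0) (c := 0) (b' := c) (c' := 0) (N := N)
    fun n hn => ?_
  have := mul_nonneg (h n hn) (Nat.cast_nonneg n)
  linarith

theorem sq_le_four_mul_of_forall_nat {a b c : ℚ} (ha : 0 ≤ a) (hb : 0 ≤ b)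
    (h : ∀ u v : ℕ, 0 < v → b * u * v ≤ a * u ^ 2 + c * v ^ 2) : b ^ 2 ≤ 4 * a * c := by
  rcases ha.eq_or_lt with rfl | ha
  · have : 0 ≤ -b := nonneg_of_eventually_nonneg (c := c) (N := 0) fun n _ => by
      have := h n 1 one_pos
      push_cast at this
      linarith
    have hb0 : b = 0 := by linarith
    subst hb0
    simp
  -- The minimum of `a t² - b t + c` is at `t = b / (2a)`, which is rational and nonnegative, hence
  -- of the form `u / v`.
  · set t : ℚ := b / (2 * a) with ht
    have ht0 : 0 ≤ t := by positivity
    have hnum : ((t.num.toNat : ℕ) : ℚ) = t * t.den := by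
      rw [Rat.mul_den_eq_num]
      exact_mod_cast Int.toNat_of_nonneg (Rat.num_nonneg.mpr ht0)
    have h1 := h t.num.toNat t.den t.den_pos
    rw [hnum] at h1
    have hd : (0 : ℚ) < (t.den : ℚ) ^ 2 := by have := t.den_pos; positivity
    have h2 : b * t ≤ a * t ^ 2 + c := by
      refine le_of_mul_le_mul_right ?_ hd
      linarith
    have hta : t * (2 * a) = b := by rw [ht]; field_simp
    have h3 : b * t * (4 * a) ≤ (a * t ^ 2 + c) * (4 * a) :=
      mul_le_mul_of_nonneg_right h2 (by linarith)
    have h4 : b * t * (4 * a) = 2 * b ^ 2 := by rw [← hta]; ring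
    have h5 : (a * t ^ 2 + c) * (4 * a) = b ^ 2 + 4 * a * c := by rw [← hta]; ring
    linarith

end Quadratics

/-! ### Slicing by powers of a superficial element -/

section Slices

variable {R : Type*} [CommRing R] {I J 𝔞 : Ideal R} {r₀ c : ℕ} {f : R}

theorem IsSuperficial.pow (h : IsSuperficial I J 𝔞 r₀ c f) (k : ℕ) :
    IsSuperficial I J 𝔞 r₀ (k * c) (f ^ k) := by
  refine ⟨?_, ?_, ?_⟩
  · rw [mul_comm, pow_mul]
    exact Ideal.pow_mem_pow h.mem k
  · induction k with
    | zero => intro r _ s x _ hx; simpa using hx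
    | succ k ih =>
      intro r hr s x hx hxf
      refine ih r hr s x hx (h.mem_of_mul_mem (r + k * c) (by omega) s _
        (Ideal.mul_mem_right _ _ hx) ?_)
      rw [mul_assoc, ← pow_succ]
      convert hxf using 4
      ring
  · induction k with
    | zero => intro x _ hx; simpa using hx
    | succ k ih =>
      intro x hx hxf
      refine ih x hx (h.mem_of_mul_mem_base _ (Ideal.mul_mem_right _ _ hx) ?_)
      rwa [mul_assoc, ← pow_succ]

theorem colon_pow_colon (L : Ideal R) (f : R) (k : ℕ) :
    (L.colon {f ^ k}).colon {f} = L.colon {f ^ (k + 1)} := by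
  ext x
  rw [Submodule.mem_colon_singleton, Submodule.mem_colon_singleton, Submodule.mem_colon_singleton,
    smul_eq_mul, smul_eq_mul, smul_eq_mul, mul_assoc, ← pow_succ']

theorem colength_eq_sum_slices {L : Ideal R} (hL : FiniteColength L) (f : R) (T : ℕ) :
    colength L = colength (L.colon {f ^ T}) +
      ∑ k ∈ Finset.range T, colength (L.colon {f ^ k} ⊔ Ideal.span {f}) := by
  induction T with
  | zero =>
    have : L.colon {f ^ 0} = L := by
      ext x
      rw [Submodule.mem_colon_singleton, pow_zero, smul_eq_mul, mul_one]
    rw [this, Finset.sum_range_zero, add_zero]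
  | succ T ih =>
    rw [Finset.sum_range_succ, ih, ← colon_pow_colon,
      colength_eq_colon_add (hL.mono (le_colon_singleton L (f ^ T))) f]
    ring

theorem colength_le_colength_add {K L : Ideal R} (hKfin : FiniteColength K)
    (hL : FiniteColength L) (x : R)
    (hK : ∀ g ∈ K, g * x ∈ L) : colength L ≤ colength K + colength (L ⊔ Ideal.span {x}) := by
  rw [colength_eq_colon_add hL x]
  exact Nat.add_le_add_right (colength_antitone hKfin fun g hg =>
    Submodule.mem_colon_singleton.mpr (hK g hg)) _

/-- Here `g y f ^ k ∈ I ^ (k c + r) * J ^ m`, and `f ^ k` is superficial of degree `k c` with the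
same `r₀`, so it cancels. -/
theorem IsSuperficial.mul_mem (h : IsSuperficial I J ⊥ r₀ c f) {k m r : ℕ} (hr : r₀ ≤ r)
    {g y : R} (hg : g ∈ (J ^ m).colon {f ^ k}) (hy : y ∈ I ^ (k * c + r)) :
    g * y ∈ I ^ r * J ^ m := by
  have h1 := (h.pow k).mem_of_mul_mem r hr m (g * y) ?_ ?_
  · rwa [sup_bot_eq] at h1
  · rw [sup_bot_eq]
    exact Ideal.mul_mem_left _ _ (Ideal.pow_le_pow_right (by omega) hy)
  · rw [sup_bot_eq, mul_right_comm, mul_comm _ y, add_comm r]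
    exact Ideal.mul_mem_mul hy (Submodule.mem_colon_singleton.mp hg)

end Slices

/-! ### Hilbert polynomials and their leading coefficients -/

section Minkowski

variable {R : Type*} [CommRing R] [IsLocalRing R] [IsNoetherianRing R]

open IsLocalRing

theorem exists_colength_pow_eq (hdim : ringKrullDim R ≤ 2) {I : Ideal R}
    (hI : I.radical = maximalIdeal R) :
    ∃ a b c : ℚ, ∃ N : ℕ, ∀ n ≥ N, (colength (I ^ n) : ℚ) = a * n ^ 2 + b * n + c := by
  obtain ⟨a, b, c, d, e, g, -, -, N, hN⟩ := eventuallyPoly_colength 2 le_rfl hI hI ⊥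
    (dimensionLE_of_ringKrullDim_le hdim ⊥)
  -- Write `I ^ n = I ^ (n - N) * I ^ N` and use the Bhattacharya polynomial of `I` with itself at
  -- `s = N`.
  refine ⟨a, (b - 2 * a) * N + d, (a - b + c) * N ^ 2 + (e - d) * N + g, 2 * N, fun n hn => ?_⟩
  obtain ⟨k, rfl⟩ := Nat.exists_eq_add_of_le' (show N ≤ n by omega)
  have := hN k (by omega) N le_rfl
  simp only [sup_bot_eq, ← pow_add] at this
  rw [this]
  push_cast
  ring

theorem exists_pow_le_pow {I J : Ideal R} (hI : I.radical = maximalIdeal R)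
    (hJ : J.radical = maximalIdeal R) : ∃ t, I ^ t ≤ J := by
  obtain ⟨t, ht⟩ := exists_pow_le_of_radical_eq hJ
  refine ⟨t, (Ideal.pow_right_mono ?_ t).trans ht⟩
  rw [← hI]
  exact Ideal.le_radical

/-- If `I ^ t ≤ J`, then `I ^ (n + t N) ≤ I ^ n * J ^ N ≤ I ^ n` with `N` fixed, so the coefficients
of `n²` agree. -/
theorem leadingCoeff_pow_eq {I J : Ideal R} (hI : I.radical = maximalIdeal R)
    (hJ : J.radical = maximalIdeal R) {a b c d e g a' b' c' : ℚ} {N N' : ℕ}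
    (hN : ∀ r ≥ N, ∀ s ≥ N, (colength (I ^ r * J ^ s) : ℚ) =
      a * r ^ 2 + b * (r * s) + c * s ^ 2 + d * r + e * s + g)
    (hN' : ∀ n ≥ N', (colength (I ^ n) : ℚ) = a' * n ^ 2 + b' * n + c') : a' = a := by
  have hfin := finiteColength_pow_mul_pow hI hJ
  have hfin' : ∀ n, FiniteColength (I ^ n) := fun n => by simpa using hfin n 0
  obtain ⟨t, ht⟩ := exists_pow_le_pow hI hJ
  apply le_antisymm
  · refine leadingCoeff_le_of_eventually_le (b := b') (c := c') (b' := b * N + d)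
      (c' := c * N ^ 2 + e * N + g) (N := N + N') fun n hn => ?_
    have h1 : (colength (I ^ n) : ℚ) ≤ colength (I ^ n * J ^ N) := by
      exact_mod_cast colength_antitone (hfin n N) Ideal.mul_le_left
    rw [hN n (by omega) N le_rfl, hN' n (by omega)] at h1
    linarith
  · refine leadingCoeff_le_of_eventually_le (b := b * N + d) (c := c * N ^ 2 + e * N + g)
      (b' := b' + 2 * a' * (t * N)) (c' := a' * (t * N) ^ 2 + b' * (t * N) + c') (N := N + N')
      fun n hn => ?_
    have h1 : (colength (I ^ n * J ^ N) : ℚ) ≤ colength (I ^ (n + t * N)) := by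
      refine Nat.cast_le.mpr (colength_antitone (hfin' _) ?_)
      rw [pow_add, pow_mul]
      exact Ideal.mul_mono le_rfl (Ideal.pow_right_mono ht N)
    rw [hN n (by omega) N le_rfl, hN' _ (by omega)] at h1
    push_cast at h1
    linarith

end Minkowski

/-! ### Lower bound for the slices and the discriminant inequality -/

section SliceBounds

variable {R : Type*} [CommRing R] {I J 𝔞 : Ideal R} {r₀ c : ℕ} {f : R}

theorem IsSuperficial.colength_le_add (h : IsSuperficial I J 𝔞 r₀ c f)
    (hfin : ∀ r s, FiniteColength (I ^ r * J ^ s)) {r : ℕ} (hr : r₀ ≤ r) (s : ℕ) :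
    colength (I ^ (r + c) * J ^ s ⊔ 𝔞) ≤
      colength (I ^ r * J ^ s ⊔ 𝔞) + colength (I ^ (r + c) * J ^ s ⊔ (𝔞 ⊔ Ideal.span {f})) := by
  have hL : FiniteColength (I ^ r₀ ⊔ 𝔞) := by
    simpa using (hfin r₀ 0).mono (le_sup_left : _ ≤ _ ⊔ 𝔞)
  have h1 := h.colength_add hfin hr s
  have h2 := colength_antitone hL
    (le_sup_right : _ ≤ (I ^ (r + c) * J ^ s ⊔ 𝔞).colon {f} ⊔ (I ^ r₀ ⊔ 𝔞))
  omega

theorem IsSuperficial.colength_sup_add_le (h : IsSuperficial I J 𝔞 r₀ c f)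
    (hfin : ∀ r s, FiniteColength (I ^ r * J ^ s)) {r : ℕ} (hr : r₀ ≤ r) (s : ℕ) :
    colength (I ^ (r + c) * J ^ s ⊔ (𝔞 ⊔ Ideal.span {f})) + colength (I ^ r * J ^ s ⊔ 𝔞) ≤
      colength (I ^ (r + c) * J ^ s ⊔ 𝔞) + colength (I ^ r₀ ⊔ 𝔞) := by
  have h1 := h.colength_add hfin hr s
  omega

variable [IsLocalRing R] [IsNoetherianRing R]

open IsLocalRing

/-- Modulo a superficial element `f` of degree `c`, there are elements in suitable powers of `I`
of controlled colength. -/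
theorem IsSuperficial.exists_colength_sup_le (hf : IsSuperficial I J ⊥ r₀ c f)
    (hI : I.radical = maximalIdeal R) (hJ : J.radical = maximalIdeal R) {α β γ : ℚ} {N : ℕ}
    (hN : ∀ n ≥ N, (colength (I ^ n) : ℚ) = α * n ^ 2 + β * n + γ) :
    ∃ C : ℚ, ∃ δ : ℕ, 0 < δ ∧ ∀ j, ∃ h ∈ I ^ (j * δ), ∀ n₁, ∃ n ≥ n₁,
      (colength (I ^ n ⊔ (Ideal.span {f} ⊔ Ideal.span {h})) : ℚ) ≤ 2 * α * c * (j * δ) + C := by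
  have hfin := finiteColength_pow_mul_pow hI hJ
  -- Modulo `f`, the colength of `I ^ n` grows linearly with slope `2 α c`, up to a bounded error in
  -- both directions.
  have lower : ∀ n, r₀ + N ≤ n → 2 * α * c * n + α * c ^ 2 + β * c ≤
      colength (I ^ (n + c) ⊔ Ideal.span {f}) := by
    intro n hn
    have h1 := hf.colength_le_add hfin (r := n) (by omega) 0
    simp only [pow_zero, mul_one, sup_bot_eq, bot_sup_eq] at h1
    have h2 : (colength (I ^ (n + c)) : ℚ) ≤
      colength (I ^ n) + colength (I ^ (n + c) ⊔ Ideal.span {f}) := by exact_mod_cast h1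
    rw [hN _ (by omega), hN _ (by omega)] at h2
    push_cast at h2
    linarith
  have upper : ∀ n, r₀ + N ≤ n → (colength (I ^ (n + c) ⊔ Ideal.span {f}) : ℚ) ≤
      2 * α * c * n + α * c ^ 2 + β * c + colength (I ^ r₀) := by
    intro n hn
    have h1 := hf.colength_sup_add_le hfin (r := n) (by omega) 0
    simp only [pow_zero, mul_one, sup_bot_eq, bot_sup_eq] at h1
    have h2 : (colength (I ^ (n + c) ⊔ Ideal.span {f}) : ℚ) + colength (I ^ n) ≤
      colength (I ^ (n + c)) + colength (I ^ r₀) := by exact_mod_cast h1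
    rw [hN _ (by omega), hN _ (by omega)] at h2
    push_cast at h2
    linarith
  obtain ⟨c₁, n₀, hsup⟩ := exists_isSuperficial I J (Ideal.span {f})
  obtain ⟨h, hh⟩ := hsup (c₁ + 1) (by omega)
  -- The powers of one superficial `h` share the threshold `n₀`, so the error does not depend on
  -- `j`.
  refine ⟨colength (I ^ r₀) + colength (I ^ n₀ ⊔ Ideal.span {f}), c₁ + 1, by omega, fun j =>
    ⟨h ^ j, (hh.pow j).mem, fun n₁ =>
      ⟨n₁ + r₀ + N + n₀ + c + j * (c₁ + 1), by omega, ?_⟩⟩⟩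
  set n := n₁ + r₀ + N + n₀ with hn
  have h1 := (hh.pow j).colength_sup_add_le hfin (r := n + c) (by omega) 0
  simp only [pow_zero, mul_one] at h1
  have h2 : (colength (I ^ (n + c + j * (c₁ + 1)) ⊔ (Ideal.span {f} ⊔ Ideal.span {h ^ j})) : ℚ) +
      colength (I ^ (n + c) ⊔ Ideal.span {f}) ≤
      colength (I ^ (n + c + j * (c₁ + 1)) ⊔ Ideal.span {f}) +
        colength (I ^ n₀ ⊔ Ideal.span {f}) := by exact_mod_cast h1
  have h3 := lower n (by omega)
  have h4 := upper (n + j * (c₁ + 1)) (by omega)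
  rw [show n + j * (c₁ + 1) + c = n + c + j * (c₁ + 1) by ring] at h4
  push_cast at h4 ⊢
  linarith

/-- Choose `h` in a power of `I` with exponent about `k c + r + c`. Multiplication by `h` carries
the slice ideal into `L = I ^ (r + c) * J ^ m + (f)`, so the slice has length at least that of `R /
L` minus that of `R / (L + (h))`. The first is at least `b c m` plus a constant, the second at most
`2 a c² k` plus a constant. -/
theorem exists_slice_bound (hI : I.radical = maximalIdeal R) (hJ : J.radical = maximalIdeal R)
    {a b γ d e g β' γ' : ℚ} {N N' : ℕ} (ha : 0 ≤ a)
    (hN : ∀ r ≥ N, ∀ s ≥ N, (colength (I ^ r * J ^ s) : ℚ) =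
      a * r ^ 2 + b * (r * s) + γ * s ^ 2 + d * r + e * s + g)
    (hN' : ∀ n ≥ N', (colength (I ^ n) : ℚ) = a * n ^ 2 + β' * n + γ') :
    ∃ f : R, ∃ c : ℕ, 0 < c ∧ ∃ C : ℚ, ∃ M : ℕ, ∀ m ≥ M, ∀ k : ℕ,
      b * c * m - 2 * a * c ^ 2 * k - C ≤
        colength ((J ^ m).colon {f ^ k} ⊔ Ideal.span {f}) := by
  have hfin := finiteColength_pow_mul_pow hI hJ
  obtain ⟨c₀, r₀, hsup⟩ := exists_isSuperficial I J ⊥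
  obtain ⟨f, hf⟩ := hsup (c₀ + 1) (by omega)
  obtain ⟨C, δ, hδ, hC⟩ := hf.exists_colength_sup_le hI hJ hN'
  obtain ⟨t, ht⟩ := exists_pow_le_pow hI hJ
  set c := c₀ + 1 with hc
  set r := r₀ + N with hr
  refine ⟨f, c, by omega, 2 * a * c * (r + c + δ) + C - (a * (2 * r * c + c ^ 2) + d * c), N,
    fun m hm k => ?_⟩
  -- Only exponents divisible by `δ` are available. Rounding up costs at most `δ`, absorbed in the
  -- constant.
  set j := (k * c + (r + c)) / δ + 1 with hj
  have hj1 : k * c + (r + c) ≤ j * δ := by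
    have := Nat.lt_div_mul_add (a := k * c + (r + c)) hδ
    rw [hj, add_mul, one_mul]
    exact this.le
  have hj2 : j * δ ≤ k * c + (r + c) + δ := by
    have := Nat.div_mul_le_self (k * c + (r + c)) δ
    rw [hj, add_mul, one_mul]
    omega
  obtain ⟨h, hh, hhn⟩ := hC j
  -- Large enough that `I ^ n ≤ I ^ (r + c) * J ^ m`.
  obtain ⟨n, hn, hhn⟩ := hhn (r + c + t * m)
  set L : Ideal R := I ^ (r + c) * J ^ m ⊔ Ideal.span {f} with hL
  have hLfin : FiniteColength L := (hfin _ _).mono le_sup_left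
  have hKfin : FiniteColength ((J ^ m).colon {f ^ k} ⊔ Ideal.span {f}) := by
    have h0 : FiniteColength (J ^ m) := by simpa using hfin 0 m
    exact h0.mono ((le_colon_singleton _ _).trans le_sup_left)
  have h1 : colength L ≤ colength ((J ^ m).colon {f ^ k} ⊔ Ideal.span {f}) +
      colength (L ⊔ Ideal.span {h}) := by
    refine colength_le_colength_add hKfin hLfin h fun x hx => ?_
    obtain ⟨u, hu, v, hv, rfl⟩ := Submodule.mem_sup.mp hx
    rw [add_mul]
    refine Ideal.add_mem _ (Ideal.mem_sup_left ?_) (Ideal.mem_sup_right (Ideal.mul_mem_right _ _ hv))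
    exact hf.mul_mem (by omega) hu (Ideal.pow_le_pow_right hj1 hh)
  have h2 : colength (L ⊔ Ideal.span {h}) ≤
      colength (I ^ n ⊔ (Ideal.span {f} ⊔ Ideal.span {h})) := by
    have hn' : FiniteColength (I ^ n) := by simpa using hfin n 0
    refine colength_antitone (hn'.mono le_sup_left) ?_
    rw [hL, sup_assoc]
    refine sup_le_sup_right ((Ideal.pow_le_pow_right hn).trans ?_) _
    rw [pow_add, pow_mul]
    exact Ideal.mul_mono le_rfl (Ideal.pow_right_mono ht m)
  have h3 := hf.colength_le_add hfin (r := r) (by omega) m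
  rw [sup_bot_eq, sup_bot_eq, bot_sup_eq, ← hL] at h3
  have h4 : (colength (I ^ (r + c) * J ^ m) : ℚ) ≤ colength (I ^ r * J ^ m) +
      (colength ((J ^ m).colon {f ^ k} ⊔ Ideal.span {f}) +
        colength (I ^ n ⊔ (Ideal.span {f} ⊔ Ideal.span {h}))) := by
    exact_mod_cast (h3.trans (Nat.add_le_add_left (h1.trans (Nat.add_le_add_left h2 _)) _))
  rw [hN _ (by omega) m hm, hN _ (by omega) m hm] at h4
  have h5 : (j * δ : ℚ) ≤ k * c + (r + c) + δ := by exact_mod_cast hj2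
  have h6 : 2 * a * c * (j * δ : ℚ) ≤ 2 * a * c * (k * c + (r + c) + δ) :=
    mul_le_mul_of_nonneg_left h5 (by positivity)
  push_cast at h4
  linarith

theorem minkowski_discriminant (hI : I.radical = maximalIdeal R) (hJ : J.radical = maximalIdeal R)
    {a b γ d e g β' γ' β'' γ'' : ℚ} {N N' N'' : ℕ}
    (hN : ∀ r ≥ N, ∀ s ≥ N, (colength (I ^ r * J ^ s) : ℚ) =
      a * r ^ 2 + b * (r * s) + γ * s ^ 2 + d * r + e * s + g)
    (hN' : ∀ n ≥ N', (colength (I ^ n) : ℚ) = a * n ^ 2 + β' * n + γ')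
    (hN'' : ∀ n ≥ N'', (colength (J ^ n) : ℚ) = γ * n ^ 2 + β'' * n + γ'') :
    0 ≤ a ∧ 0 ≤ γ ∧ b ^ 2 ≤ 4 * a * γ := by
  have hfin := finiteColength_pow_mul_pow hI hJ
  have ha : 0 ≤ a := leadingCoeff_le_of_eventually_le (b := 0) (c := 0) (b' := β') (c' := γ')
    (N := N') fun n hn => by
      rw [← hN' n hn]
      simp
  have hγ : 0 ≤ γ := leadingCoeff_le_of_eventually_le (b := 0) (c := 0) (b' := β'') (c' := γ'')
    (N := N'') fun n hn => by
      rw [← hN'' n hn]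
      simp
  have hb : 0 ≤ b := nonneg_of_eventually_nonneg (c := a * (2 * N + 1) + d) (N := N) fun s hs => by
    have h1 : (colength (I ^ N * J ^ s) : ℚ) ≤ colength (I ^ (N + 1) * J ^ s) :=
      Nat.cast_le.mpr (colength_antitone (hfin _ _) (pow_mul_pow_le (by omega) le_rfl))
    rw [hN N le_rfl s hs, hN (N + 1) (by omega) s hs] at h1
    push_cast at h1
    linarith
  refine ⟨ha, hγ, ?_⟩
  obtain ⟨f, c, hc, C, M, hM⟩ := exists_slice_bound hI hJ ha hN hN'
  have key : ∀ m ≥ M, ∀ T : ℕ,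
      T * (b * c * m - C) - a * c ^ 2 * (T * (T - 1)) ≤ colength (J ^ m) := by
    intro m hm T
    have hJm : FiniteColength (J ^ m) := by simpa using hfin 0 m
    have h1 := colength_eq_sum_slices hJm f T
    have h2 : ∑ k ∈ Finset.range T, (b * c * m - 2 * a * c ^ 2 * k - C) ≤
        ((∑ k ∈ Finset.range T, colength ((J ^ m).colon {f ^ k} ⊔ Ideal.span {f}) : ℕ) : ℚ) := by
      rw [Nat.cast_sum]
      exact Finset.sum_le_sum fun k _ => hM m hm k
    have h3 : ∑ k ∈ Finset.range T, (b * c * m - 2 * a * c ^ 2 * k - C) =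
        T * (b * c * m - C) - a * c ^ 2 * (T * (T - 1)) := by
      clear h1 h2
      induction T with
      | zero => simp
      | succ T ih =>
        rw [Finset.sum_range_succ, ih]
        push_cast
        ring
    rw [← h3]
    refine h2.trans (Nat.cast_le.mpr ?_)
    omega
  refine sq_le_four_mul_of_forall_nat ha hb fun u v hv => ?_
  have hcq : (0 : ℚ) < (c : ℚ) ^ 2 := by positivity
  -- Take `m = c v n` and `T = u n` slices, then compare the coefficients of `n²`.
  have hlead : b * u * v * c ^ 2 - a * c ^ 2 * u ^ 2 ≤ γ * c ^ 2 * v ^ 2 := by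
    refine leadingCoeff_le_of_eventually_le (b := u * (a * c ^ 2 - C)) (c := 0)
      (b' := β'' * (c * v)) (c' := γ'') (N := M + N'') fun n hn => ?_
    have hle : n ≤ c * v * n := Nat.le_mul_of_pos_left n (Nat.mul_pos hc hv)
    have h1 := key (c * v * n) (by omega) (u * n)
    rw [hN'' _ (by omega)] at h1
    push_cast at h1
    linarith
  refine le_of_mul_le_mul_right ?_ hcq
  linarith

end SliceBounds

/-! ### From eventual formulas to the polynomials and multiplicities -/

section Polynomials

variable {R : Type*} [CommRing R]

theorem existsUnique_isHilbertPolynomial {I : Ideal R} (hfin : ∀ n, FiniteColength (I ^ n))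
    {a b c : ℚ} {N : ℕ} (hN : ∀ n ≥ N, (colength (I ^ n) : ℚ) = a * n ^ 2 + b * n + c) :
    (∃! P : Polynomial ℚ, IsHilbertPolynomial 2 I P) ∧ idealMultiplicity 2 I = 2 * a := by
  let Q : Polynomial ℚ := .C a * .X ^ 2 + .C b * .X + .C c
  have hQ : IsHilbertPolynomial 2 I Q := by
    refine ⟨Polynomial.natDegree_quadratic_le, N, fun n hn => ⟨colength (I ^ n), ?_, ?_⟩⟩
    · exact (hfin n).coe_colength.symm
    · simp [Q, hN n hn]
  have huniq : ∀ P, IsHilbertPolynomial 2 I P → P = Q := by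
    rintro P ⟨-, M, hM⟩
    refine Polynomial.eq_of_infinite_eval_eq P Q
      (((Set.Ici_infinite (max M N)).image Nat.cast_injective.injOn).mono ?_)
    rintro _ ⟨n, hn, rfl⟩
    have hn' : max M N ≤ n := hn
    obtain ⟨l, hl, hPl⟩ := hM n (by omega)
    rw [← (hfin n).coe_colength, Nat.cast_inj] at hl
    change P.eval (n : ℚ) = Q.eval (n : ℚ)
    rw [hPl, ← hl, hN n (by omega)]
    simp [Q]
  refine ⟨⟨Q, hQ, huniq⟩, ?_⟩
  have : hilbertPolynomial 2 I = Q := huniq _ (Classical.epsilon_spec ⟨Q, hQ⟩)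
  have hcoeff : Q.coeff 2 = a := by simp [Q]
  rw [idealMultiplicity, this, hcoeff, Nat.factorial_two, Nat.cast_ofNat]

/-- The bivariate monomial `t x ^ i y ^ j`. -/
noncomputable def bivariateMonomial (i j : ℕ) (t : ℚ) : MvPolynomial (Fin 2) ℚ :=
  MvPolynomial.monomial (Finsupp.single 0 i + Finsupp.single 1 j) t

theorem totalDegree_bivariateMonomial_le (i j : ℕ) (t : ℚ) :
    (bivariateMonomial i j t).totalDegree ≤ i + j := by
  refine (MvPolynomial.totalDegree_monomial_le _ _).trans ?_
  rw [Finsupp.sum_add_index' (by simp) (by simp), Finsupp.sum_single_index (by simp),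
    Finsupp.sum_single_index (by simp)]
  rfl

theorem eval_bivariateMonomial (i j : ℕ) (t x y : ℚ) :
    MvPolynomial.eval ![x, y] (bivariateMonomial i j t) = t * (x ^ i * y ^ j) := by
  rw [bivariateMonomial, MvPolynomial.eval_monomial, Finsupp.prod_add_index' (by simp)
    (by simp [pow_add]), Finsupp.prod_single_index (by simp), Finsupp.prod_single_index (by simp)]
  rfl

theorem coeff_bivariateMonomial (i j k l : ℕ) (t : ℚ) :
    (bivariateMonomial i j t).coeff (Finsupp.single 0 k + Finsupp.single 1 l) =
      if i = k ∧ j = l then t else 0 := by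
  rw [bivariateMonomial, MvPolynomial.coeff_monomial]
  refine if_congr ⟨fun h => ⟨?_, ?_⟩, fun h => by rw [h.1, h.2]⟩ rfl rfl
  · simpa using DFunLike.congr_fun h 0
  · simpa using DFunLike.congr_fun h 1

theorem existsUnique_isBhattacharyaPolynomial {I J : Ideal R}
    (hfin : ∀ r s, FiniteColength (I ^ r * J ^ s)) {a b c d e g : ℚ} {N : ℕ}
    (hN : ∀ r ≥ N, ∀ s ≥ N, (colength (I ^ r * J ^ s) : ℚ) =
      a * r ^ 2 + b * (r * s) + c * s ^ 2 + d * r + e * s + g) :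
    (∃! P : MvPolynomial (Fin 2) ℚ, IsBhattacharyaPolynomial 2 I J P) ∧
      mixedMultiplicity 2 1 I J = b := by
  let Q : MvPolynomial (Fin 2) ℚ := bivariateMonomial 2 0 a + bivariateMonomial 1 1 b +
    bivariateMonomial 0 2 c + bivariateMonomial 1 0 d + bivariateMonomial 0 1 e +
    bivariateMonomial 0 0 g
  have heval : ∀ r ≥ N, ∀ s ≥ N,
      MvPolynomial.eval ![(r : ℚ), (s : ℚ)] Q = colength (I ^ r * J ^ s) := by
    intro r hr s hs
    rw [hN r hr s hs]
    simp only [Q, map_add, eval_bivariateMonomial]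
    ring
  have hQ : IsBhattacharyaPolynomial 2 I J Q := by
    refine ⟨?_, N, fun r s hr hs => ⟨colength (I ^ r * J ^ s), ?_, heval r hr s hs⟩⟩
    · have hadd : ∀ p q : MvPolynomial (Fin 2) ℚ, p.totalDegree ≤ 2 → q.totalDegree ≤ 2 →
          (p + q).totalDegree ≤ 2 := fun p q hp hq =>
        (MvPolynomial.totalDegree_add p q).trans (max_le hp hq)
      have hmon : ∀ i j t, i + j ≤ 2 → (bivariateMonomial i j t).totalDegree ≤ 2 :=
        fun i j t h => (totalDegree_bivariateMonomial_le i j t).trans h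
      exact hadd _ _ (hadd _ _ (hadd _ _ (hadd _ _ (hadd _ _ (hmon _ _ _ (by norm_num))
        (hmon _ _ _ (by norm_num))) (hmon _ _ _ (by norm_num))) (hmon _ _ _ (by norm_num)))
        (hmon _ _ _ (by norm_num))) (hmon _ _ _ (by norm_num))
    · exact (hfin r s).coe_colength.symm
  have huniq : ∀ P, IsBhattacharyaPolynomial 2 I J P → P = Q := by
    rintro P ⟨-, M, hM⟩
    refine MvPolynomial.funext_set (fun _ => (Nat.cast : ℕ → ℚ) '' Set.Ici (max M N))
      (fun _ => (Set.Ici_infinite _).image Nat.cast_injective.injOn) fun x hx => ?_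
    obtain ⟨r, hr, hxr⟩ := hx 0 trivial
    obtain ⟨s, hs, hxs⟩ := hx 1 trivial
    have hr' : max M N ≤ r := hr
    have hs' : max M N ≤ s := hs
    have hx' : x = ![(r : ℚ), (s : ℚ)] := by
      ext i
      fin_cases i
      · exact hxr.symm
      · exact hxs.symm
    obtain ⟨l, hl, hPl⟩ := hM r s (by omega) (by omega)
    rw [← (hfin r s).coe_colength, Nat.cast_inj] at hl
    rw [hx', hPl, ← hl, heval r (by omega) s (by omega)]
  refine ⟨⟨Q, hQ, huniq⟩, ?_⟩
  have : bhattacharyaPolynomial 2 I J = Q := huniq _ (Classical.epsilon_spec ⟨Q, hQ⟩)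
  rw [mixedMultiplicity, this]
  simp only [Q, MvPolynomial.coeff_add, coeff_bivariateMonomial]
  norm_num [Nat.factorial]

end Polynomials

/-! ### The theorem -/

/-- The first four conjuncts say that the polynomials which define the (mixed) multiplicities
exist and are unique. -/
theorem theorem5p3 {R : Type*} [CommRing R] [IsLocalRing R] [IsNoetherianRing R]
    (hdim : ringKrullDim R = 2) (I J : Ideal R)
    (hI : IsMaximalPrimary I) (hJ : IsMaximalPrimary J) :
    (∃! P : Polynomial ℚ, IsHilbertPolynomial 2 I P) ∧
    (∃! P : Polynomial ℚ, IsHilbertPolynomial 2 J P) ∧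
    (∃! P : Polynomial ℚ, IsHilbertPolynomial 2 (I * J) P) ∧
    (∃! P : MvPolynomial (Fin 2) ℚ, IsBhattacharyaPolynomial 2 I J P) ∧
    idealMultiplicity 2 (I * J) ≤ 2 * idealMultiplicity 2 I + 2 * idealMultiplicity 2 J ∧
    mixedMultiplicity 2 1 I J ^ 2 ≤ idealMultiplicity 2 I * idealMultiplicity 2 J := by
  replace hI := hI.2
  replace hJ := hJ.2
  have hfin := finiteColength_pow_mul_pow hI hJ
  obtain ⟨a, b, c, d, e, g, -, -, N, hN⟩ := eventuallyPoly_colength 2 le_rfl hI hJ ⊥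
    (dimensionLE_of_ringKrullDim_le hdim.le ⊥)
  simp only [sup_bot_eq] at hN
  obtain ⟨a', β', γ', N', hN'⟩ := exists_colength_pow_eq hdim.le hI
  obtain ⟨c', β'', γ'', N'', hN''⟩ := exists_colength_pow_eq hdim.le hJ
  obtain rfl : a' = a := leadingCoeff_pow_eq hI hJ hN hN'
  obtain rfl : c' = c := leadingCoeff_pow_eq (a := c) (b := b) (c := a') (d := e) (e := d) (g := g)
    (N := N) hJ hI (fun r hr s hs => by rw [mul_comm, hN s hs r hr]; ring) hN''
  obtain ⟨ha, hc, hbac⟩ := minkowski_discriminant hI hJ hN hN' hN''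
  have hIJ : ∀ n ≥ N, (colength ((I * J) ^ n) : ℚ) =
      (a' + b + c') * n ^ 2 + (d + e) * n + g := fun n hn => by
    rw [mul_pow, hN n hn n hn]
    ring
  obtain ⟨h1, h1'⟩ := existsUnique_isHilbertPolynomial (fun n => by simpa using hfin n 0) hN'
  obtain ⟨h2, h2'⟩ := existsUnique_isHilbertPolynomial (fun n => by simpa using hfin 0 n) hN''
  obtain ⟨h3, h3'⟩ := existsUnique_isHilbertPolynomial
    (fun n => by rw [mul_pow]; exact hfin n n) hIJ
  obtain ⟨h4, h4'⟩ := existsUnique_isBhattacharyaPolynomial hfin hN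
  refine ⟨h1, h2, h3, h4, ?_, ?_⟩
  · rw [h1', h2', h3']
    -- From `b² ≤ 4 a' c' ≤ (a' + c')²`.
    have hb : b ≤ a' + c' := by
      refine (abs_le_of_sq_le_sq' ?_ (add_nonneg ha hc)).2
      nlinarith [sq_nonneg (a' - c')]
    linarith
  · rw [h1', h2', h4']
    linarith
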